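/- **Setting.** Fix $n,d\ge 1$, $\epsilon,\delta\in(0,1)$ with $n/\delta\ge 2$ (automatic for $n\ge 2$), sellers $x_1,\dots,x_n\in\mathbb{R}^d$ and deadlines $d_1,\dots,d_n\in\mathbb{N}$. All sellers are on the market at time $0$. At each of the times $t=1,2,\dots$ one node arrives: either a buyer $y\in\mathbb{R}^d$, or the $i$-th seller, who then (re-)enters the market. At time $t=d_i$ seller $i$ leaves the market (before the arrival at time $t$ is processed). The weight of the edge between seller $x_i$ and buyer $y$ is $\|y-x_i\|_2$. A matching assigns to some of the sellers one buyer each, no buyer being assigned twice, such that seller $i$ is on the market at the arrival time of the assigned buyer; its weight is the sum of the weights of its edges, and $\mathrm{opt}$ is the largest weight of a matching of the sellers to the buyers that have arrived so far. **Algorithm.** \textsc{FastGreedy} with constant $C$ is the following randomized data structure. * \textsc{Init}$(x_1,\dots,x_n,\epsilon,\delta)$, which also receives the deadlines, sets $s=\lceil C\epsilon^{-2}\log(n/\delta)\rceil$, samples $M\in\{\pm1/\sqrt s\}^{s\times d}$ with independent uniform signs, computes $\widetilde x_i=Mx_i$, and sets the matching values $w_i$ and their total $p$ to $0$. * \textsc{Query}$(y)$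 returns $\widetilde w_i=\|My-\widetilde x_i\|_2$ for all $i\in[n]$. * \textsc{Update} advances the clock, and removes the sellers whose deadline has come. If the arriving node is a seller, it puts this seller on the market. If it is a buyer $y$, it calls \textsc{Query}$(y)$ and chooses $i_0$ maximizing $\widetilde w_i-w_i$ among the sellers on the market (if there are any); if $\widetilde w_{i_0}>w_{i_0}$, it assigns $y$ to $i_0$ (replacing an earlier buyer), adds $\widetilde w_{i_0}-w_{i_0}$ to $p$, and sets $w_{i_0}=\widetilde w_{i_0}$. * \textsc{TotalWeight} returns $p$. Running time is the number of steps, and space the number of memory cells, of an explicit program on a real RAM (unit-cost arithmetic, square root, logarithm, comparison, memory access and random bit; rounding a real number $r$ up costs $O(1+\lceil r\rceil)$). The inputs are fixed independently of the random bits. **Theorem.** There are an absolute constant $C$ and absolute constants hidden in the $O(\cdot)$ below, such that for all data as above, \textsc{FastGreedy} has the following properties, after any sequence of calls of \textsc{Update}, \textsc{Query} and \textsc{TotalWeight}. 1. It uses $O(nd+\epsilon^{-2}(n+d)\log(n/\delta))$ space. 2. \textsc{Init} runs in time $O(\epsilon^{-2}nd\log(n/\delta))$, \textsc{Update} and \textsc{Query}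 run in time $O(\epsilon^{-2}(n+d)\log(n/\delta))$, and \textsc{TotalWeight} runs in time $O(1)$. 3. For every $y\in\mathbb{R}^d$, with probability at least $1-\delta$, \textsc{Query}$(y)$ returns $\widetilde w_1,\dots,\widetilde w_n$ such that $(1-\epsilon)\|y-x_i\|_2\le\widetilde w_i\le(1+\epsilon)\|y-x_i\|_2$ for all $i\in[n]$. 4. If at most $n$ buyers have arrived, then with probability at least $1-\delta$ the assignment $m$ of buyers to sellers that \textsc{FastGreedy} maintains is a matching, the value $p$ returned by \textsc{TotalWeight} satisfies $(1-\epsilon)\,w(m)\le p\le(1+\epsilon)\,w(m)$, where $w(m)$ is the (true) weight of $m$, and $p\ge\frac{1-\epsilon}{2}\,\mathrm{opt}$ and $w(m)\ge\frac{1-\epsilon}{2}\,\mathrm{opt}$. -/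

import Mathlib

open MeasureTheory

/-! A randomized real RAM: a structured programming language over a memory of integer cells and
real cells, in which every operation is charged for. Cells are organised in arrays, named by the
types `I` (integer arrays) and `R` (real arrays); a scalar is cell `0` of its array. -/

namespace RealRAM

variable {I R : Type}

/-- The memory: contents of the cells, the set of cells written so far (inputs included), the tape
of random bits and the number of bits already read from it. -/
structure Mem (I R : Type) where
  int : I → ℕ → ℕ
  real : R → ℕ → ℝ
  used : Finset (I × ℕ ⊕ R × ℕ)
  tape : ℕ → Bool
  pos : ℕ

/-- The space consumption: the number of distinct memory cells used so far. -/
def Mem.space (σ : Mem I R) : ℕ := σ.used.card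

/-- The blank memory with random tape `ω`. -/
def Mem.blank (ω : ℕ → Bool) : Mem I R :=
  { int := fun _ _ => 0, real := fun _ _ => 0, used := ∅, tape := ω, pos := 0 }

section Write

variable [DecidableEq I] [DecidableEq R]

/-- Write `v` into the integer cell `a[k]`. -/
def Mem.setInt (σ : Mem I R) (a : I) (k v : ℕ) : Mem I R :=
  { σ with
    int := fun b l => if b = a ∧ l = k then v else σ.int b l
    used := insert (Sum.inl (a, k)) σ.used }

/-- Write `v` into the real cell `a[k]`. -/
def Mem.setReal (σ : Mem I R) (a : R) (k : ℕ) (v : ℝ) : Mem I R :=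
  { σ with
    real := fun b l => if b = a ∧ l = k then v else σ.real b l
    used := insert (Sum.inr (a, k)) σ.used }

/-- Write a vector into the cells `a[0], …, a[m-1]` (used to pass arguments). -/
def Mem.loadInt (σ : Mem I R) (a : I) {m : ℕ} (v : Fin m → ℕ) : Mem I R :=
  { σ with
    int := fun b l => if h : b = a ∧ l < m then v ⟨l, h.2⟩ else σ.int b l
    used := σ.used ∪ (Finset.range m).image fun l => Sum.inl (a, l) }

/-- Write a vector into the cells `a[0], …, a[m-1]` (used to pass arguments). -/
def Mem.loadReal (σ : Mem I R) (a : R) {m : ℕ} (v : Fin m → ℝ) : Mem I R :=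
  { σ with
    real := fun b l => if h : b = a ∧ l < m then v ⟨l, h.2⟩ else σ.real b l
    used := σ.used ∪ (Finset.range m).image fun l => Sum.inr (a, l) }

end Write

/-- Integer expressions; `get a e` is the content of the cell `a[e]`. -/
inductive IExp (I : Type) : Type
  | const (k : ℕ)
  | get (a : I) (e : IExp I)
  | add (e f : IExp I)
  | mul (e f : IExp I)

/-- Real expressions; `get a e` is the content of the cell `a[e]`. -/
inductive RExp (I R : Type) : Type
  | ofInt (e : IExp I)
  | get (a : R) (e : IExp I)
  | add (e f : RExp I R)
  | sub (e f : RExp I R)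
  | mul (e f : RExp I R)
  | div (e f : RExp I R)
  | sqrt (e : RExp I R)
  | log (e : RExp I R)

/-- Comparisons. -/
inductive Cond (I R : Type) : Type
  | intEq (e f : IExp I)
  | realLt (e f : RExp I R)

/-- Commands. `setInt a e f` is `a[e] ← f`, likewise `setReal`; `ceil a e f` is `a[e] ← ⌈f⌉`;
`flip a e` writes a fresh random bit (`0` or `1`) into `a[e]`; `loop a e c` is
`for a = 0, 1, …, e - 1 do c`, where the bound `e` is evaluated once, before the loop. -/
inductive Cmd (I R : Type) : Type
  | skip
  | seq (c c' : Cmd I R)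
  | setInt (a : I) (e f : IExp I)
  | setReal (a : R) (e : IExp I) (f : RExp I R)
  | ceil (a : I) (e : IExp I) (f : RExp I R)
  | flip (a : I) (e : IExp I)
  | ite (b : Cond I R) (c c' : Cmd I R)
  | loop (a : I) (e : IExp I) (c : Cmd I R)

/-- A scalar integer variable. -/
def ivar (a : I) : IExp I := .get a (.const 0)

/-- A scalar real variable. -/
def rvar (a : R) : RExp I R := .get a (.const 0)

/-- Sequential composition of a list of commands. -/
def block : List (Cmd I R) → Cmd I R
  | [] => .skip
  | c :: cs => .seq c (block cs)

def IExp.eval (σ : Mem I R) : IExp I → ℕ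
  | .const k => k
  | .get a e => σ.int a (e.eval σ)
  | .add e f => e.eval σ + f.eval σ
  | .mul e f => e.eval σ * f.eval σ

noncomputable def RExp.eval (σ : Mem I R) : RExp I R → ℝ
  | .ofInt e => (e.eval σ : ℝ)
  | .get a e => σ.real a (e.eval σ)
  | .add e f => e.eval σ + f.eval σ
  | .sub e f => e.eval σ - f.eval σ
  | .mul e f => e.eval σ * f.eval σ
  | .div e f => e.eval σ / f.eval σ
  | .sqrt e => Real.sqrt (e.eval σ)
  | .log e => Real.log (e.eval σ)

def Cond.eval (σ : Mem I R) : Cond I R → Prop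
  | .intEq e f => e.eval σ = f.eval σ
  | .realLt e f => e.eval σ < f.eval σ

/-- Every constant, memory access and arithmetic operation costs one step. -/
def IExp.cost : IExp I → ℕ
  | .const _ => 1
  | .get _ e => e.cost + 1
  | .add e f => e.cost + f.cost + 1
  | .mul e f => e.cost + f.cost + 1

def RExp.cost : RExp I R → ℕ
  | .ofInt e => e.cost + 1
  | .get _ e => e.cost + 1
  | .add e f => e.cost + f.cost + 1
  | .sub e f => e.cost + f.cost + 1
  | .mul e f => e.cost + f.cost + 1
  | .div e f => e.cost + f.cost + 1
  | .sqrt e => e.cost + 1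
  | .log e => e.cost + 1

def Cond.cost : Cond I R → ℕ
  | .intEq e f => e.cost + f.cost + 1
  | .realLt e f => e.cost + f.cost + 1

section Exec

variable [DecidableEq I] [DecidableEq R]

/-- The memory after `N` rounds of a loop with counter `a` and body `body`. -/
def iterate (a : I) (body : Mem I R → Mem I R) (σ : Mem I R) : ℕ → Mem I R
  | 0 => σ
  | k + 1 => body ((iterate a body σ k).setInt a 0 k)

open Classical in
/-- The memory after the execution of a command. -/
noncomputable def Cmd.exec : Cmd I R → Mem I R → Mem I R
  | .skip, σ => σ
  | .seq c c', σ => c'.exec (c.exec σ)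
  | .setInt a e f, σ => σ.setInt a (e.eval σ) (f.eval σ)
  | .setReal a e f, σ => σ.setReal a (e.eval σ) (f.eval σ)
  | .ceil a e f, σ => σ.setInt a (e.eval σ) ⌈f.eval σ⌉₊
  | .flip a e, σ =>
      { σ.setInt a (e.eval σ) (if σ.tape σ.pos then 1 else 0) with pos := σ.pos + 1 }
  | .ite b c c', σ => if b.eval σ then c.exec σ else c'.exec σ
  | .loop a e c, σ => iterate a c.exec σ (e.eval σ)

open Classical in
/-- The running time of a command: every assignment, random bit, comparison and loop round costs
one step, on top of the expressions that it evaluates. Rounding a real number up costs as many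
additional steps as it takes to count up to the result. -/
noncomputable def Cmd.cost : Cmd I R → Mem I R → ℕ
  | .skip, _ => 0
  | .seq c c', σ => c.cost σ + c'.cost (c.exec σ)
  | .setInt _ e f, _ => e.cost + f.cost + 1
  | .setReal _ e f, _ => e.cost + f.cost + 1
  | .ceil _ e f, σ => e.cost + f.cost + 1 + ⌈f.eval σ⌉₊
  | .flip _ e, _ => e.cost + 1
  | .ite b c c', σ => b.cost + if b.eval σ then c.cost σ else c'.cost σ
  | .loop a e c, σ => e.cost + 1 +
      ∑ k ∈ Finset.range (e.eval σ), (c.cost ((iterate a c.exec σ k).setInt a 0 k) + 1)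

end Exec

end RealRAM

/-! The online matching problem. The sellers are the points `x 0, …, x (n-1)`, all of them on the
market at time `0`. At each of the times `1, 2, …` one node arrives. -/

namespace OnlineMatching

variable {n d : ℕ}

/-- The node arriving online: the `i`-th seller, who (re-)enters the market, or a buyer. -/
inductive Arrival (n d : ℕ) : Type
  | seller (i : Fin n)
  | buyer (y : EuclideanSpace ℝ (Fin d))

/-- Whether seller `i` is on the market at time `t`, where `as[t - 1]` arrives at time `t`. The
seller leaves the market when the clock shows the deadline `dl i`. -/
def OnMarket (dl : Fin n → ℕ) (as : List (Arrival n d)) (i : Fin n) : ℕ → Prop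
  | 0 => True
  | t + 1 => as[t]? = some (.seller i) ∨ (dl i ≠ t + 1 ∧ OnMarket dl as i t)

/-- `IsBuyer as t y`: the node arriving at time `t` is a buyer, located at `y`. -/
def IsBuyer (as : List (Arrival n d)) (t : ℕ) (y : EuclideanSpace ℝ (Fin d)) : Prop :=
  1 ≤ t ∧ as[t - 1]? = some (.buyer y)

/-- A matching of the sellers to the buyers (identified with their arrival times): each buyer gets
at most one seller, who is on the market when the buyer arrives. -/
structure IsMatching (dl : Fin n → ℕ) (as : List (Arrival n d)) (m : Fin n → Option ℕ) :
    Prop where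
  feasible : ∀ i t, m i = some t → (∃ y, IsBuyer as t y) ∧ OnMarket dl as i t
  injective : ∀ i j t, m i = some t → m j = some t → i = j

/-- The weight of the edge between seller `i` and the buyer arriving at time `t`: their Euclidean
distance (`0` if no buyer arrives at time `t`). -/
noncomputable def edgeWeight (x : Fin n → EuclideanSpace ℝ (Fin d)) (as : List (Arrival n d))
    (i : Fin n) (t : ℕ) : ℝ :=
  match as[t - 1]? with
  | some (.buyer y) => ‖y - x i‖
  | _ => 0

/-- The weight of a matching. -/
noncomputable def weight (x : Fin n → EuclideanSpace ℝ (Fin d)) (as : List (Arrival n d))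
    (m : Fin n → Option ℕ) : ℝ :=
  ∑ i, match m i with
    | some t => edgeWeight x as i t
    | none => 0

/-- The offline optimum: the largest weight of a matching. -/
noncomputable def opt (x : Fin n → EuclideanSpace ℝ (Fin d)) (dl : Fin n → ℕ)
    (as : List (Arrival n d)) : ℝ :=
  sSup {W | ∃ m, IsMatching dl as m ∧ W = weight x as m}

/-- The number of buyers among the arrivals. -/
def numBuyers : List (Arrival n d) → ℕ
  | [] => 0
  | .seller _ :: as => numBuyers as
  | .buyer _ :: as => numBuyers as + 1

end OnlineMatching

/-! The data structure. -/

namespace FastGreedy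

open RealRAM OnlineMatching

/-- Integer members, arguments and local variables: numbers `n`, `d`, `s`, deadlines `dl`,
`flag`, matched buyers `m` (arrival time of the buyer, `0` if none), current `time`, the argument
`who` of an update (`0` for a buyer, `i + 1` for the `i`-th seller), loop counters `i`, `j`, `k`,
a random `bit`, and the variables `found`, `best` of the search for the best seller. -/
inductive IName : Type
  | n | d | s | dl | flag | m | time | who | i | j | k | bit | found | best
  deriving DecidableEq

/-- Real members, arguments and local variables: precision `eps`, failure tolerance `delta`, points
`x`, sketched points `xs`, sketching matrix `M`, matching values `w`, their total `p`, the argument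
`y` of an update or a query, its sketch `ys`, an accumulator `acc`, the answer `ws` of a query and
the answer `out` of `TotalWeight`. Matrices are stored row by row. -/
inductive RName : Type
  | eps | delta | x | xs | M | w | p | y | ys | acc | ws | out
  deriving DecidableEq

abbrev Program := Cmd IName RName

abbrev Memory := Mem IName RName

/-- The index `a * len + b` of an entry of a matrix with rows of length `len`. -/
def idx (a len b : IName) : IExp IName := .add (.mul (ivar a) (ivar len)) (ivar b)

/-- `s ← ⌈C ε⁻² log (n / δ)⌉`; sample a matrix with `s` rows and entries `± 1 / √s`; sketch all
sellers. -/
def init (C : ℕ) : Program := block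
  [.setReal .p (.const 0) (.ofInt (.const 0)),
   .setInt .time (.const 0) (.const 0),
   .ceil .s (.const 0)
     (.mul (.div (.ofInt (.const C)) (.mul (rvar .eps) (rvar .eps)))
       (.log (.div (.ofInt (ivar .n)) (rvar .delta)))),
   .loop .i (ivar .s) <| .loop .j (ivar .d) <| block
     [.flip .bit (.const 0),
      .ite (.intEq (ivar .bit) (.const 1))
        (.setReal .M (idx .i .d .j)
          (.div (.ofInt (.const 1)) (.sqrt (.ofInt (ivar .s)))))
        (.setReal .M (idx .i .d .j)
          (.sub (.ofInt (.const 0)) (.div (.ofInt (.const 1)) (.sqrt (.ofInt (ivar .s))))))],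
   .loop .i (ivar .n) <| block
     [.setReal .w (ivar .i) (.ofInt (.const 0)),
      .setInt .flag (ivar .i) (.const 1),
      .setInt .m (ivar .i) (.const 0),
      .loop .k (ivar .s) <| block
        [.setReal .xs (idx .i .s .k) (.ofInt (.const 0)),
         .loop .j (ivar .d) <|
           .setReal .xs (idx .i .s .k)
             (.add (.get .xs (idx .i .s .k))
               (.mul (.get .M (idx .k .d .j)) (.get .x (idx .i .d .j))))]]]

/-- Sketch the query point and compute its sketched distances to all sellers. -/
def query : Program := block
  [.loop .k (ivar .s) <| block
     [.setReal .ys (ivar .k) (.ofInt (.const 0)),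
      .loop .j (ivar .d) <|
        .setReal .ys (ivar .k)
          (.add (.get .ys (ivar .k)) (.mul (.get .M (idx .k .d .j)) (.get .y (ivar .j))))],
   .loop .i (ivar .n) <| block
     [.setReal .acc (.const 0) (.ofInt (.const 0)),
      .loop .k (ivar .s) <|
        .setReal .acc (.const 0)
          (.add (rvar .acc)
            (.mul (.sub (.get .ys (ivar .k)) (.get .xs (idx .i .s .k)))
              (.sub (.get .ys (ivar .k)) (.get .xs (idx .i .s .k))))),
      .setReal .ws (ivar .i) (.sqrt (rvar .acc))]]

/-- `best ← argmax {ws[i] - w[i] : flag[i] = 1}`; `found` tells whether there is such an `i`. -/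
def search : Program := block
  [.setInt .found (.const 0) (.const 0),
   .loop .i (ivar .n) <|
     .ite (.intEq (.get .flag (ivar .i)) (.const 1))
       (.ite (.intEq (ivar .found) (.const 0))
         (block
           [.setInt .found (.const 0) (.const 1),
            .setInt .best (.const 0) (ivar .i)])
         (.ite (.realLt (.sub (.get .ws (ivar .best)) (.get .w (ivar .best)))
              (.sub (.get .ws (ivar .i)) (.get .w (ivar .i))))
           (.setInt .best (.const 0) (ivar .i))
           .skip))
       .skip]

/-- Advance the clock and remove the sellers whose deadline has come. An arriving seller enters the
market. An arriving buyer is matched to the seller for whom the matching value grows most, if it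
grows at all. -/
def update : Program := block
  [.setInt .time (.const 0) (.add (ivar .time) (.const 1)),
   .loop .i (ivar .n) <|
     .ite (.intEq (.get .dl (ivar .i)) (ivar .time))
       (.setInt .flag (ivar .i) (.const 0))
       .skip,
   .loop .i (ivar .n) <|
     .ite (.intEq (ivar .who) (.add (ivar .i) (.const 1)))
       (.setInt .flag (ivar .i) (.const 1))
       .skip,
   .ite (.intEq (ivar .who) (.const 0))
     (block
       [query,
        search,
        .ite (.intEq (ivar .found) (.const 1))
          (.ite (.realLt (.get .w (ivar .best)) (.get .ws (ivar .best)))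
            (block
              [.setInt .m (ivar .best) (ivar .time),
               .setReal .p (.const 0)
                 (.sub (.add (rvar .p) (.get .ws (ivar .best))) (.get .w (ivar .best))),
               .setReal .w (ivar .best) (.get .ws (ivar .best))])
            .skip)
          .skip])
     .skip]

def totalWeight : Program := .setReal .out (.const 0) (rvar .p)

variable {n d : ℕ}

/-- The memory in which `init` is called. -/
noncomputable def initInput (ε δ : ℝ) (x : Fin n → EuclideanSpace ℝ (Fin d)) (dl : Fin n → ℕ)
    (ω : ℕ → Bool) : Memory :=
  (((((Mem.blank ω).setInt .n 0 n).setInt .d 0 d).setReal .eps 0 ε).setReal .delta 0 δ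
    |>.loadReal .x (fun l : Fin (n * d) => x l.divNat l.modNat)).loadInt .dl dl

/-- The calls that the data structure accepts after its initialization. -/
inductive Call (n d : ℕ) : Type
  | update (a : Arrival n d)
  | query (y : EuclideanSpace ℝ (Fin d))
  | totalWeight

/-- Pass the arguments of a call. -/
noncomputable def Call.load (σ : Memory) : Call n d → Memory
  | .update (.seller i) => σ.setInt .who 0 (i + 1)
  | .update (.buyer y) => (σ.setInt .who 0 0).loadReal .y (fun j => y j)
  | .query y => σ.loadReal .y (fun j => y j)
  | .totalWeight => σ

def Call.program : Call n d → Program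
  | .update _ => FastGreedy.update
  | .query _ => FastGreedy.query
  | .totalWeight => FastGreedy.totalWeight

/-- The memory after a call. -/
noncomputable def Call.run (c : Call n d) (σ : Memory) : Memory := c.program.exec (c.load σ)

/-- The running time of a call. -/
noncomputable def Call.time (c : Call n d) (σ : Memory) : ℕ := c.program.cost (c.load σ)

/-- The running time of the initialization. -/
noncomputable def initTime (C : ℕ) (ε δ : ℝ) (x : Fin n → EuclideanSpace ℝ (Fin d))
    (dl : Fin n → ℕ) (ω : ℕ → Bool) : ℕ :=
  (init C).cost (initInput ε δ x dl ω)

/-- The memory after the initialization and a sequence of calls. -/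
noncomputable def state (C : ℕ) (ε δ : ℝ) (x : Fin n → EuclideanSpace ℝ (Fin d))
    (dl : Fin n → ℕ) (calls : List (Call n d)) (ω : ℕ → Bool) : Memory :=
  calls.foldl (fun σ c => c.run σ) ((init C).exec (initInput ε δ x dl ω))

/-- The arrivals in a sequence of calls. -/
def arrivals : List (Call n d) → List (Arrival n d)
  | [] => []
  | .update a :: cs => a :: arrivals cs
  | .query _ :: cs => arrivals cs
  | .totalWeight :: cs => arrivals cs

/-- The estimate of the distance from `y` to seller `i` that a query returns. -/
noncomputable def estimate (σ : Memory) (y : EuclideanSpace ℝ (Fin d)) (i : Fin n) : ℝ :=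
  ((Call.query y : Call n d).run σ).real .ws i

/-- The value that `TotalWeight` returns. -/
noncomputable def totalWeightValue (n d : ℕ) (σ : Memory) : ℝ :=
  ((Call.totalWeight : Call n d).run σ).real .out 0

/-- The matching that the data structure maintains. -/
def matching (n : ℕ) (σ : Memory) (i : Fin n) : Option ℕ :=
  if σ.int .m i = 0 then none else some (σ.int .m i)

/-- The law of a tape of independent fair random bits. -/
noncomputable def fairCoins : Measure (ℕ → Bool) :=
  Measure.infinitePi fun _ => (PMF.uniformOfFintype Bool).toMeasure

end FastGreedy

/-! Chance enters through a single event: the sign matrix distorts by little the distances between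
the fixed sellers and a fixed list of query points. Everything else holds for every tape of random
bits.

Sketch. For a unit vector, one row of signs gives a signed sum `X` with mean 0, variance 1 and
subgaussian parameter 1. Writing `exp (t X²)` as a Gaussian average of `exp (√(2t) X g)` bounds the
moment generating function of `X²` (`mgf_sq_le_of_hasSubgaussianMGF`). It also bounds the fourth
moment of `X`, from which the lower tail follows (`mgf_neg_sq_le_of_hasSubgaussianMGF`). A Chernoff
bound over `s` independent rows shows that the norm of a fixed vector is distorted by more than `1 ±
η` with probability at most `2 exp (-s η² / 12)` (`sketchNorm_distortion`). With `C = 144` and `η ≥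
ε / 2` this is at most `2 (δ / n)³`, and a union bound over at most `n²` pairs suffices
(`sketch_accurate`). The union bound is legitimate because the inputs do not depend on the bits.

Greedy. Measure edges by their estimated weights. The values `w i` and the gains `g t` made at the
arrivals form a feasible dual solution: `w i + g t` dominates the edge when the buyer arrives, by
maximality of the chosen gain, and keeps doing so because `w i` never decreases. Both `∑ w i` and `∑
g t` equal `p`, so weak duality bounds every matching by `2 p` (`GreedyInv.weight_le`). Since `w i`
is the estimated weight of the current edge at `i`, `p` is also the estimated weight of the
maintained matching. Distortion `ε / 2` transfers both facts to true weights
(`GreedyInv.competitive`).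

Programs. Cost and space come from a compositional judgement `Runs`, which tracks only the scalar
variables and the cells written. Values come from loop invariants together with syntactic lists of
the arrays that a command can modify. The outcome is `inv_state`: at all times the memory holds a
greedy state for the sketched distances. -/

/-! ### Exponential moments of squares of subgaussian variables. -/

open ProbabilityTheory in
theorem lintegral_exp_mul_sq_gaussian {t : ℝ} (ht : t < 1 / 2) :
    ∫⁻ g, ENNReal.ofReal (Real.exp (t * g ^ 2)) ∂(gaussianReal 0 1) =
      ENNReal.ofReal (Real.sqrt (1 - 2 * t))⁻¹ := by
  have hb : 0 < 1 / 2 - t := by linarith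
  rw [gaussianReal_of_var_ne_zero _ one_ne_zero,
    lintegral_withDensity_eq_lintegral_mul _ (measurable_gaussianPDF 0 1) (by fun_prop)]
  have h : ∀ g : ℝ, (gaussianPDF 0 1 * fun g => ENNReal.ofReal (Real.exp (t * g ^ 2))) g =
      ENNReal.ofReal ((Real.sqrt (2 * Real.pi))⁻¹ * Real.exp (-(1 / 2 - t) * g ^ 2)) := by
    intro g
    rw [Pi.mul_apply, gaussianPDF, ← ENNReal.ofReal_mul (gaussianPDFReal_nonneg _ _ _),
      gaussianPDFReal, mul_assoc, ← Real.exp_add]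
    congr 3
    · simp
    · simp; ring
  simp_rw [h]
  rw [← ofReal_integral_eq_lintegral_ofReal ((integrable_exp_neg_mul_sq hb).const_mul _)
    (ae_of_all _ fun g => by positivity), integral_const_mul, integral_gaussian]
  congr 1
  rw [← Real.sqrt_inv, ← Real.sqrt_inv, ← Real.sqrt_mul (by positivity)]
  congr 1
  have h1 : (1 - 2 * t) ≠ 0 := by linarith
  have h2 : (1 / 2 - t) ≠ 0 := hb.ne'
  have := Real.pi_ne_zero
  field_simp

-- An auxiliary Gaussian `g` linearizes the square: `exp (t X²)` is the mean over `g` of `exp (√(2t)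
-- X g)`. After exchanging the integrals, the subgaussian bound at the argument `√(2t) g` replaces
-- `X` by a standard Gaussian.
open ProbabilityTheory in
theorem mgf_sq_le_of_hasSubgaussianMGF {Ω : Type*} [MeasurableSpace Ω] {μ : Measure Ω}
    [IsProbabilityMeasure μ] {X : Ω → ℝ} (hX : HasSubgaussianMGF X 1 μ) (hm : Measurable X)
    {t : ℝ} (h0 : 0 ≤ t) (ht : t < 1 / 2) :
    ∫ ω, Real.exp (t * X ω ^ 2) ∂μ ≤ (Real.sqrt (1 - 2 * t))⁻¹ := by
  set r := Real.sqrt (2 * t) with hr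
  have hr2 : r ^ 2 = 2 * t := Real.sq_sqrt (by linarith)
  have key : ∫⁻ ω, ENNReal.ofReal (Real.exp (t * X ω ^ 2)) ∂μ ≤
      ENNReal.ofReal (Real.sqrt (1 - 2 * t))⁻¹ := by
    calc ∫⁻ ω, ENNReal.ofReal (Real.exp (t * X ω ^ 2)) ∂μ
        = ∫⁻ ω, ∫⁻ g, ENNReal.ofReal (Real.exp (r * X ω * g)) ∂(gaussianReal 0 1) ∂μ := by
          refine lintegral_congr fun ω => ?_
          rw [← ofReal_integral_eq_lintegral_ofReal (integrable_exp_mul_gaussianReal _)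
            (ae_of_all _ fun g => by positivity)]
          congr 1
          have := congrFun (mgf_id_gaussianReal (μ := 0) (v := 1)) (r * X ω)
          simp only [mgf, id] at this
          rw [this]
          congr 1
          simp only [NNReal.coe_one, mul_pow, hr2]; ring
      _ = ∫⁻ g, ∫⁻ ω, ENNReal.ofReal (Real.exp (r * X ω * g)) ∂μ ∂(gaussianReal 0 1) := by
          apply lintegral_lintegral_swap
          apply Measurable.aemeasurable
          have : Measurable fun p : Ω × ℝ => X p.1 := hm.comp measurable_fst
          simp only [Function.uncurry_def]
          fun_prop
      _ ≤ ∫⁻ g, ENNReal.ofReal (Real.exp (t * g ^ 2)) ∂(gaussianReal 0 1) := by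
          refine lintegral_mono fun g => ?_
          have hi := hX.integrable_exp_mul (r * g)
          have hle := hX.mgf_le (r * g)
          simp only [mgf] at hle
          have e : ∀ ω, r * X ω * g = r * g * X ω := fun ω => by ring
          simp_rw [e]
          rw [← ofReal_integral_eq_lintegral_ofReal hi (ae_of_all _ fun g => by positivity)]
          apply ENNReal.ofReal_le_ofReal
          refine hle.trans_eq ?_
          congr 1
          simp only [NNReal.coe_one, mul_pow, hr2]; ring
      _ = _ := lintegral_exp_mul_sq_gaussian ht
  rw [integral_eq_lintegral_of_nonneg_ae (ae_of_all _ fun g => by positivity)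
    (by fun_prop)]
  exact ENNReal.toReal_le_of_le_ofReal (by positivity) key

/-- The expansion `-log (1 - 2 t) / 2 = t + t² + …` has a remainder that `2 t²` absorbs for `t ≤ 1 /
4`. The proof squares and uses the quadratic lower bound of the exponential. -/
theorem inv_sqrt_one_sub_le {t : ℝ} (h0 : 0 ≤ t) (ht : t ≤ 1 / 4) :
    (Real.sqrt (1 - 2 * t))⁻¹ ≤ Real.exp (t + 2 * t ^ 2) := by
  have h1 : Real.exp (-(t + 2 * t ^ 2)) ≤ Real.sqrt (1 - 2 * t) := by
    apply Real.le_sqrt_of_sq_le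
    rw [← Real.exp_nat_mul]
    have h2 : (1 - 2 * t) * (1 + 2 * t + 4 * t ^ 2) ≥ 1 - 8 * t ^ 3 := by nlinarith
    have h3 := Real.quadratic_le_exp_of_nonneg (x := 2 * t + 4 * t ^ 2) (by positivity)
    have h4 : 1 ≤ (1 - 2 * t) * Real.exp (2 * t + 4 * t ^ 2) := by
      refine le_trans ?_ (mul_le_mul_of_nonneg_left h3 (by linarith))
      have ht2 : 0 ≤ t ^ 2 * (1 / 4 - t) := by
        apply mul_nonneg (by positivity); linarith
      have ht3 : 0 ≤ t ^ 3 * (1 / 4 - t) := by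
        apply mul_nonneg (by positivity); linarith
      have ht4 : 0 ≤ t ^ 4 * (1 / 4 - t) := by
        apply mul_nonneg (by positivity); linarith
      nlinarith [pow_nonneg h0 3, pow_nonneg h0 4]
    have h5 : Real.exp (((2 : ℕ) : ℝ) * -(t + 2 * t ^ 2)) * Real.exp (2 * t + 4 * t ^ 2) = 1 := by
      rw [← Real.exp_add, Real.exp_eq_one_iff]; push_cast; ring
    nlinarith [Real.exp_pos (2 * t + 4 * t ^ 2),
      Real.exp_pos (((2 : ℕ) : ℝ) * -(t + 2 * t ^ 2))]
  rw [← neg_neg (t + 2 * t ^ 2), Real.exp_neg]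
  exact inv_anti₀ (Real.exp_pos _) h1

/-- This holds because `(1 - y + y²/2) (1 + y + y²/2) = 1 + y⁴/4 ≥ 1`. -/
theorem exp_neg_le_quadratic {y : ℝ} (hy : 0 ≤ y) : Real.exp (-y) ≤ 1 - y + y ^ 2 / 2 := by
  have h := Real.quadratic_le_exp_of_nonneg hy
  have h1 : Real.exp (-y) * Real.exp y = 1 := by rw [← Real.exp_add]; simp
  have h2 : 0 < 1 - y + y ^ 2 / 2 := by nlinarith [sq_nonneg (y - 1)]
  have h3 : 1 ≤ (1 - y + y ^ 2 / 2) * Real.exp y := by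
    refine le_trans ?_ (mul_le_mul_of_nonneg_left h h2.le)
    nlinarith [sq_nonneg (y ^ 2)]
  exact le_of_mul_le_mul_right (h1.trans_le h3) (Real.exp_pos y)

-- Averaging `exp (-y) ≤ 1 - y + y²/2` at `y = t X²` reduces the claim to a bound for the fourth
-- moment, which is read off from the exponential moment of `X²` at `1/4`. The hypothesis `hi` is
-- automatic on a finite probability space, where the lemma is applied.
open ProbabilityTheory in
theorem mgf_neg_sq_le_of_hasSubgaussianMGF {Ω : Type*} [MeasurableSpace Ω] {μ : Measure Ω}
    [IsProbabilityMeasure μ] {X : Ω → ℝ} (hX : HasSubgaussianMGF X 1 μ) (hm : Measurable X)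
    (hi : ∀ f : ℝ → ℝ, Integrable (fun ω => f (X ω)) μ)
    (h2 : ∫ ω, X ω ^ 2 ∂μ = 1) {t : ℝ} (h0 : 0 ≤ t) :
    ∫ ω, Real.exp (-t * X ω ^ 2) ∂μ ≤ Real.exp (-t + 3 * t ^ 2) := by
  have h4 : ∫ ω, X ω ^ 4 ∂μ ≤ 6 := by
    have h := mgf_sq_le_of_hasSubgaussianMGF hX hm (t := 1 / 4) (by norm_num) (by norm_num)
    -- A rational upper bound for `√2`, chosen so that `1 + 1/4 + m/32 ≤ 23/16` is exactly `m ≤ 6`.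
    have hs : (Real.sqrt (1 - 2 * (1 / 4)))⁻¹ ≤ 23 / 16 := by
      rw [inv_le_comm₀ (Real.sqrt_pos.2 (by norm_num)) (by norm_num)]
      exact Real.le_sqrt_of_sq_le (by norm_num)
    have hlow : ∫ ω, (1 + 1 / 4 * X ω ^ 2 + 1 / 32 * X ω ^ 4) ∂μ ≤
        ∫ ω, Real.exp (1 / 4 * X ω ^ 2) ∂μ := by
      refine integral_mono (hi fun x => 1 + 1 / 4 * x ^ 2 + 1 / 32 * x ^ 4)
        (hi fun x => Real.exp (1 / 4 * x ^ 2)) fun ω => ?_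
      have := Real.quadratic_le_exp_of_nonneg (x := 1 / 4 * X ω ^ 2) (by positivity)
      refine le_trans (le_of_eq ?_) this
      ring
    rw [integral_add (hi fun x => 1 + 1 / 4 * x ^ 2) (hi fun x => 1 / 32 * x ^ 4),
      integral_add (integrable_const _) (hi fun x => 1 / 4 * x ^ 2), integral_const_mul,
      integral_const_mul, h2] at hlow
    simp only [integral_const, probReal_univ, smul_eq_mul, mul_one] at hlow
    linarith
  have hup : ∫ ω, Real.exp (-t * X ω ^ 2) ∂μ ≤
      ∫ ω, (1 - t * X ω ^ 2 + t ^ 2 / 2 * X ω ^ 4) ∂μ := by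
    refine integral_mono (hi fun x => Real.exp (-t * x ^ 2))
      (hi fun x => 1 - t * x ^ 2 + t ^ 2 / 2 * x ^ 4) fun ω => ?_
    have := exp_neg_le_quadratic (y := t * X ω ^ 2) (by positivity)
    simp only [neg_mul]
    refine this.trans_eq ?_
    ring
  rw [integral_add (hi fun x => 1 - t * x ^ 2) (hi fun x => t ^ 2 / 2 * x ^ 4),
    integral_sub (integrable_const _) (hi fun x => t * x ^ 2), integral_const_mul,
    integral_const_mul, h2] at hup
  simp only [integral_const, probReal_univ, smul_eq_mul, mul_one] at hup
  have := Real.add_one_le_exp (-t + 3 * t ^ 2)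
  nlinarith [sq_nonneg t]

/-! ### Random signs and the Johnson-Lindenstrauss estimate. -/

/-- The value `±1` of a random bit. -/
def boolSign (b : Bool) : ℝ := if b then 1 else -1

theorem boolSign_sq (b : Bool) : boolSign b ^ 2 = 1 := by cases b <;> simp [boolSign]

/-- The law of a random bit. -/
noncomputable def fairCoin : Measure Bool := (PMF.uniformOfFintype Bool).toMeasure

instance : IsProbabilityMeasure fairCoin := by unfold fairCoin; infer_instance

theorem integral_boolSign : ∫ b, boolSign b ∂fairCoin = 0 := by
  rw [fairCoin, PMF.integral_eq_sum]
  simp [boolSign]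

/-- The law of a finite vector of random bits. -/
noncomputable abbrev fairRow (d : ℕ) : Measure (Fin d → Bool) := Measure.infinitePi fun _ => fairCoin

section JohnsonLindenstrauss

open ProbabilityTheory

/-- A signed sum of the coordinates of `v`. -/
noncomputable def signedSum {d : ℕ} (v : Fin d → ℝ) (b : Fin d → Bool) : ℝ :=
  ∑ j, boolSign (b j) * v j

theorem iIndepFun_signs {d : ℕ} (v : Fin d → ℝ) :
    iIndepFun (fun j (b : Fin d → Bool) => boolSign (b j) * v j) (fairRow d) :=
  iIndepFun_infinitePi (X := fun j b => boolSign b * v j) fun _ => measurable_of_finite _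

theorem integral_sign_mul {d : ℕ} (v : Fin d → ℝ) (j : Fin d) :
    ∫ b : Fin d → Bool, boolSign (b j) * v j ∂(fairRow d) = 0 := by
  rw [integral_mul_const]
  have hm := measurePreserving_eval_infinitePi (fun _ : Fin d => fairCoin) j
  have h := integral_boolSign
  rw [← hm.map_eq, integral_map (measurable_of_finite _).aemeasurable
    (measurable_of_finite _).aestronglyMeasurable] at h
  exact mul_eq_zero_of_left h _

/-- By Hoeffding's lemma the `j`-th term, with values in `[-|v j|, |v j|]`, has parameter `v j ^ 2`;
parameters of independent terms add up. -/
theorem hasSubgaussianMGF_signedSum {d : ℕ} (v : Fin d → ℝ) (hv : ∑ j, v j ^ 2 = 1) :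
    HasSubgaussianMGF (signedSum v) 1 (fairRow d) := by
  have h := HasSubgaussianMGF.sum_of_iIndepFun (iIndepFun_signs v) (s := Finset.univ)
    (c := fun j => (‖|v j| - -|v j|‖₊ / 2) ^ 2) fun j _ =>
      hasSubgaussianMGF_of_mem_Icc_of_integral_eq_zero (measurable_of_finite _).aemeasurable
        (ae_of_all _ fun b => ?_) (integral_sign_mul v j)
  · suffices hc : ∑ j, (‖|v j| - -|v j|‖₊ / 2) ^ 2 = 1 by
      rw [hc] at h
      exact h
    rw [← NNReal.coe_inj]
    push_cast
    rw [← hv]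
    refine Finset.sum_congr rfl fun j _ => ?_
    rw [Real.norm_eq_abs, sub_neg_eq_add, ← two_mul, abs_mul, abs_abs, abs_two,
      mul_div_cancel_left₀ _ two_ne_zero, sq_abs]
  · rw [Set.mem_Icc, ← abs_le, abs_mul]
    have : |boolSign (b j)| = 1 := by cases b j <;> simp [boolSign]
    rw [this, one_mul]

theorem integral_signedSum_sq {d : ℕ} (v : Fin d → ℝ) (hv : ∑ j, v j ^ 2 = 1) :
    ∫ b, signedSum v b ^ 2 ∂(fairRow d) = 1 := by
  have hvar := IndepFun.variance_sum (μ := fairRow d) (s := Finset.univ)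
    (X := fun j (b : Fin d → Bool) => boolSign (b j) * v j)
    (fun j _ => MemLp.of_discrete) (fun i _ j _ hij => (iIndepFun_signs v).indepFun hij)
  have h0 : ∫ b, signedSum v b ∂(fairRow d) = 0 := by
    unfold signedSum
    rw [integral_finsetSum _ fun j _ => Integrable.of_finite]
    exact Finset.sum_eq_zero fun j _ => integral_sign_mul v j
  have e : (∑ j, fun (b : Fin d → Bool) => boolSign (b j) * v j) = signedSum v := by
    ext b; simp [signedSum]
  rw [e, variance_of_integral_eq_zero (measurable_of_finite _).aemeasurable h0] at hvar
  rw [hvar, ← hv]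
  refine Finset.sum_congr rfl fun j _ => ?_
  rw [variance_of_integral_eq_zero (measurable_of_finite _).aemeasurable (integral_sign_mul v j)]
  simp [mul_pow, boolSign_sq]

/-- The law of a random matrix of bits. -/
noncomputable abbrev fairMatrix (s d : ℕ) : Measure (Fin s → Fin d → Bool) :=
  Measure.infinitePi fun _ => fairRow d

theorem mgf_sum_signedSum_sq {s d : ℕ} (v : Fin d → ℝ) (t : ℝ) :
    mgf (fun b : Fin s → Fin d → Bool => ∑ k, signedSum v (b k) ^ 2) (fairMatrix s d) t =
      (∫ b, Real.exp (t * signedSum v b ^ 2) ∂(fairRow d)) ^ s := by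
  have h := iIndepFun.mgf_sum (μ := fairMatrix s d) (t := t)
    (X := fun k (b : Fin s → Fin d → Bool) => signedSum v (b k) ^ 2)
    (iIndepFun_infinitePi (X := fun _ b => signedSum v b ^ 2) fun _ => measurable_of_finite _)
    (fun _ => measurable_of_finite _) Finset.univ
  have e : (∑ k, fun (b : Fin s → Fin d → Bool) => signedSum v (b k) ^ 2) =
      fun b => ∑ k, signedSum v (b k) ^ 2 := by
    ext b; simp
  rw [e] at h
  rw [h]
  have h1 : ∀ k ∈ (Finset.univ : Finset (Fin s)),
      mgf (fun (b : Fin s → Fin d → Bool) => signedSum v (b k) ^ 2) (fairMatrix s d) t =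
      ∫ b, Real.exp (t * signedSum v b ^ 2) ∂(fairRow d) := by
    intro k _
    have hm := (measurePreserving_eval_infinitePi (fun _ : Fin s => fairRow d) k)
    rw [← hm.map_eq, integral_map (measurable_of_finite _).aemeasurable
      (measurable_of_finite _).aestronglyMeasurable]
    rfl
  rw [Finset.prod_congr rfl h1]
  simp

theorem sum_signedSum_sq_upper_tail {s d : ℕ} (v : Fin d → ℝ) (hv : ∑ j, v j ^ 2 = 1) {η : ℝ}
    (h0 : 0 ≤ η) (h1 : η ≤ 1) :
    (fairMatrix s d).real {b | (1 + η) * s ≤ ∑ k, signedSum v (b k) ^ 2} ≤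
      Real.exp (-(s * η ^ 2 / 12)) := by
  -- Chernoff at `η / 4`, the largest scale allowed by `inv_sqrt_one_sub_le` when `η ≤ 1`. The
  -- exponent becomes `-s η² / 8`, better than needed.
  refine (measure_ge_le_exp_mul_mgf (t := η / 4) _ (by linarith) Integrable.of_finite).trans ?_
  rw [mgf_sum_signedSum_sq]
  have hX := hasSubgaussianMGF_signedSum v hv
  have hb := (mgf_sq_le_of_hasSubgaussianMGF hX (measurable_of_finite _) (t := η / 4)
    (by linarith) (by linarith)).trans (inv_sqrt_one_sub_le (by linarith) (by linarith))
  calc _ ≤ Real.exp (-(η / 4) * ((1 + η) * s)) * Real.exp (η / 4 + 2 * (η / 4) ^ 2) ^ s := by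
        gcongr
    _ ≤ _ := by
        rw [← Real.exp_nat_mul, ← Real.exp_add, Real.exp_le_exp]
        have : 0 ≤ (s : ℝ) * η ^ 2 := by positivity
        nlinarith

theorem sum_signedSum_sq_lower_tail {s d : ℕ} (v : Fin d → ℝ) (hv : ∑ j, v j ^ 2 = 1) {η : ℝ}
    (h0 : 0 ≤ η) :
    (fairMatrix s d).real {b | ∑ k, signedSum v (b k) ^ 2 ≤ (1 - η) * s} ≤
      Real.exp (-(s * η ^ 2 / 12)) := by
  -- The value `η / 6` minimizes `-t η + 3 t²`, with minimum exactly `-η² / 12`.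
  refine (measure_le_le_exp_mul_mgf (t := -(η / 6)) _ (by linarith) Integrable.of_finite).trans ?_
  rw [mgf_sum_signedSum_sq]
  have hX := hasSubgaussianMGF_signedSum v hv
  have hb := mgf_neg_sq_le_of_hasSubgaussianMGF hX (measurable_of_finite _)
    (fun f => Integrable.of_finite) (integral_signedSum_sq v hv) (t := η / 6) (by linarith)
  calc _ ≤ Real.exp (- -(η / 6) * ((1 - η) * s)) * Real.exp (-(η / 6) + 3 * (η / 6) ^ 2) ^ s := by
        gcongr
    _ ≤ _ := by
        rw [← Real.exp_nat_mul, ← Real.exp_add, Real.exp_le_exp]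
        have : 0 ≤ (s : ℝ) * η ^ 2 := by positivity
        nlinarith

/-- The norm of the image of `v` under the random sign matrix with `s` rows. -/
noncomputable def sketchNorm {d : ℕ} (ω : ℕ → Bool) (s : ℕ) (v : Fin d → ℝ) : ℝ :=
  Real.sqrt (∑ k : Fin s, (∑ j : Fin d, boolSign (ω (k * d + j)) / Real.sqrt s * v j) ^ 2)

/-- Row-major indexing is injective, so the entries read distinct, hence independent, bits of the
tape; currying then groups them into rows. -/
theorem fairCoins_map_matrix (s d : ℕ) :
    FastGreedy.fairCoins.map (fun ω (k : Fin s) (j : Fin d) => ω (k * d + j)) =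
      fairMatrix s d := by
  have hf : Function.Injective fun p : (_ : Fin s) × Fin d => (p.1 * d + p.2 : ℕ) := by
    rintro ⟨k, j⟩ ⟨k', j'⟩ h
    simp only at h
    have hd : 0 < d := j.pos
    have hk : (k : ℕ) = k' := by
      have := congrArg (· / d) h
      simpa [mul_comm _ d, Nat.mul_add_div hd, Nat.div_eq_of_lt j.2, Nat.div_eq_of_lt j'.2]
        using this
    have hj : (j : ℕ) = j' := by rw [hk] at h; omega
    obtain rfl := Fin.ext hk
    obtain rfl := Fin.ext hj
    rfl
  have h := Measure.map_infinitePi_infinitePi_of_inj (P := fun _ : ℕ => fairCoin) hf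
  have h2 := Measure.infinitePi_map_piCurry (fun (_ : Fin s) (_ : Fin d) => fairCoin)
  rw [← h, Measure.map_map (by fun_prop) (by fun_prop)] at h2
  exact h2

theorem fairCoins_matrix (s d : ℕ) (A : Set (Fin s → Fin d → Bool)) :
    FastGreedy.fairCoins.real {ω | (fun (k : Fin s) (j : Fin d) => ω (k * d + j)) ∈ A} =
      (fairMatrix s d).real A := by
  rw [← fairCoins_map_matrix, map_measureReal_apply (by fun_prop) A.toFinite.measurableSet]
  rfl

instance : IsProbabilityMeasure FastGreedy.fairCoins := by
  unfold FastGreedy.fairCoins; infer_instance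

/-- **Johnson-Lindenstrauss** for random sign matrices. -/
theorem sketchNorm_distortion {s d : ℕ} (hs : 0 < s) (v : EuclideanSpace ℝ (Fin d)) {η : ℝ}
    (h0 : 0 ≤ η) (h1 : η ≤ 1) :
    FastGreedy.fairCoins.real {ω | ¬ ((1 - η) * ‖v‖ ≤ sketchNorm ω s v ∧
      sketchNorm ω s v ≤ (1 + η) * ‖v‖)} ≤ 2 * Real.exp (-(s * η ^ 2 / 12)) := by
  by_cases hv : v = 0
  · subst hv
    simp [sketchNorm]
    positivity
  have hn : 0 < ‖v‖ := norm_pos_iff.2 hv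
  set u : Fin d → ℝ := fun j => v j / ‖v‖ with hu
  have hu1 : ∑ j, u j ^ 2 = 1 := by
    simp only [hu, div_pow, ← Finset.sum_div]
    rw [EuclideanSpace.norm_sq_eq]
    simp only [Real.norm_eq_abs, sq_abs]
    apply div_self
    have := EuclideanSpace.norm_sq_eq v
    simp only [Real.norm_eq_abs, sq_abs] at this
    rw [← this]; positivity
  have hs' : (0 : ℝ) < s := by exact_mod_cast hs
  have hsk : ∀ ω, sketchNorm ω s v = ‖v‖ * Real.sqrt ((∑ k : Fin s,
      signedSum u (fun j => ω (k * d + j)) ^ 2) / s) := by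
    intro ω
    rw [sketchNorm, ← Real.sqrt_sq hn.le, ← Real.sqrt_mul (by positivity)]
    congr 1
    rw [Finset.sum_div, Finset.mul_sum]
    refine Finset.sum_congr rfl fun k _ => ?_
    have : ∑ j : Fin d, boolSign (ω (k * d + j)) / Real.sqrt s * v j =
        ‖v‖ / Real.sqrt s * signedSum u (fun j => ω (k * d + j)) := by
      rw [signedSum, Finset.mul_sum]
      refine Finset.sum_congr rfl fun j _ => ?_
      simp only [hu]
      field_simp
    rw [this, mul_pow, div_pow, Real.sq_sqrt hs'.le]
    ring
  set A : Set (Fin s → Fin d → Bool) := {b | (1 + η) * s ≤ ∑ k, signedSum u (b k) ^ 2}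
  set B : Set (Fin s → Fin d → Bool) := {b | ∑ k, signedSum u (b k) ^ 2 ≤ (1 - η) * s}
  calc _ ≤ FastGreedy.fairCoins.real
        {ω | (fun (k : Fin s) (j : Fin d) => ω (k * d + j)) ∈ A ∪ B} := by
        refine measureReal_mono fun ω hω => ?_
        by_contra hc
        apply hω
        simp only [Set.mem_ofPred_eq, Set.mem_union, not_or, A, B, not_le] at hc
        obtain ⟨ha, hb⟩ := hc
        rw [hsk]
        rw [← lt_div_iff₀ hs'] at hb
        rw [← div_lt_iff₀ hs'] at ha
        constructor
        -- The tails concern squared norms; passing to norms uses `(1 - η)² ≤ 1 - η` here and `1 + η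
        -- ≤ (1 + η)²` below.
        · rw [mul_comm]
          refine mul_le_mul_of_nonneg_left (Real.le_sqrt_of_sq_le ?_) hn.le
          nlinarith
        · rw [mul_comm]
          refine mul_le_mul_of_nonneg_right (Real.sqrt_le_iff.2 ⟨by linarith, ?_⟩) hn.le
          nlinarith
    _ = (fairMatrix s d).real (A ∪ B) := fairCoins_matrix s d _
    _ ≤ _ := by
        refine (measureReal_union_le _ _).trans ?_
        have := sum_signedSum_sq_upper_tail (s := s) u hu1 h0 h1
        have := sum_signedSum_sq_lower_tail (s := s) u hu1 h0
        linarith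

end JohnsonLindenstrauss

/-! ### A compositional judgement for running time and cells used. -/

namespace RealRAM

variable {I R : Type} [DecidableEq I] [DecidableEq R]

/-- The scalar integer variables satisfy `Γ` and only cells in `U` have been used. -/
structure Typed (U : I × ℕ ⊕ R × ℕ → Prop) (Γ : I → ℕ → Prop) (σ : Mem I R) : Prop where
  scalar : ∀ a, Γ a (σ.int a 0)
  used : ∀ c ∈ σ.used, U c

/-- The command `c` preserves `Typed U Γ`, and costs at most `B` steps in such memories. -/
def Runs (U : I × ℕ ⊕ R × ℕ → Prop) (Γ : I → ℕ → Prop) (c : Cmd I R) (B : ℕ) : Prop :=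
  ∀ σ, Typed U Γ σ → Typed U Γ (c.exec σ) ∧ c.cost σ ≤ B

variable {U : I × ℕ ⊕ R × ℕ → Prop} {Γ : I → ℕ → Prop}

theorem Typed.setReal {σ : Mem I R} (h : Typed U Γ σ) {a : R} {k : ℕ} (v : ℝ)
    (hU : U (Sum.inr (a, k))) : Typed U Γ (σ.setReal a k v) where
  scalar := h.scalar
  used c hc := by
    rcases Finset.mem_insert.1 hc with rfl | hc
    exacts [hU, h.used c hc]

theorem Typed.setInt {σ : Mem I R} (h : Typed U Γ σ) {a : I} {k v : ℕ}
    (hΓ : k = 0 → Γ a v) (hU : U (Sum.inl (a, k))) : Typed U Γ (σ.setInt a k v) where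
  scalar b := by
    by_cases hb : b = a ∧ 0 = k
    · obtain ⟨rfl, rfl⟩ := hb
      simpa [Mem.setInt] using hΓ rfl
    · simpa [Mem.setInt, hb] using h.scalar b
  used c hc := by
    rcases Finset.mem_insert.1 hc with rfl | hc
    exacts [hU, h.used c hc]

theorem Typed.loadReal {σ : Mem I R} (h : Typed U Γ σ) {a : R} {m : ℕ} (v : Fin m → ℝ)
    (hU : ∀ k < m, U (Sum.inr (a, k))) : Typed U Γ (σ.loadReal a v) where
  scalar := h.scalar
  used c hc := by
    rcases Finset.mem_union.1 hc with hc | hc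
    · exact h.used c hc
    · obtain ⟨k, hk, rfl⟩ := Finset.mem_image.1 hc
      exact hU k (Finset.mem_range.1 hk)

theorem Typed.loadInt {σ : Mem I R} (h : Typed U Γ σ) {a : I} {m : ℕ} (v : Fin m → ℕ)
    (hΓ : ∀ v, Γ a v) (hU : ∀ k < m, U (Sum.inl (a, k))) : Typed U Γ (σ.loadInt a v) where
  scalar b := by
    by_cases hb : b = a
    · subst hb
      exact hΓ _
    · simpa [Mem.loadInt, hb] using h.scalar b
  used c hc := by
    rcases Finset.mem_union.1 hc with hc | hc
    · exact h.used c hc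
    · obtain ⟨k, hk, rfl⟩ := Finset.mem_image.1 hc
      exact hU k (Finset.mem_range.1 hk)

theorem Runs.mono {c : Cmd I R} {B B' : ℕ} (h : Runs U Γ c B) (hB : B ≤ B') : Runs U Γ c B' :=
  fun σ hσ => ⟨(h σ hσ).1, (h σ hσ).2.trans hB⟩

theorem Runs.skip : Runs U Γ (.skip : Cmd I R) 0 := fun _ hσ => ⟨hσ, le_rfl⟩

theorem Runs.nil : Runs U Γ (block [] : Cmd I R) 0 := Runs.skip

theorem Runs.cons {c : Cmd I R} {cs : List (Cmd I R)} {B B' : ℕ} (h : Runs U Γ c B)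
    (h' : Runs U Γ (block cs) B') : Runs U Γ (block (c :: cs)) (B + B') := fun σ hσ =>
  ⟨(h' _ (h σ hσ).1).1, add_le_add (h σ hσ).2 (h' _ (h σ hσ).1).2⟩

theorem Runs.setReal {a : R} {e : IExp I} {f : RExp I R}
    (hU : ∀ σ : Mem I R, (∀ a, Γ a (σ.int a 0)) → U (Sum.inr (a, e.eval σ))) :
    Runs U Γ (.setReal a e f) (e.cost + f.cost + 1) :=
  fun σ hσ => ⟨hσ.setReal _ (hU σ hσ.scalar), le_rfl⟩

theorem Runs.setInt {a : I} {e f : IExp I}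
    (hΓ : ∀ σ : Mem I R, (∀ a, Γ a (σ.int a 0)) → Γ a (f.eval σ))
    (hU : ∀ σ : Mem I R, (∀ a, Γ a (σ.int a 0)) → U (Sum.inl (a, e.eval σ))) :
    Runs U Γ (.setInt a e f : Cmd I R) (e.cost + f.cost + 1) :=
  fun σ hσ => ⟨hσ.setInt (fun _ => hΓ σ hσ.scalar) (hU σ hσ.scalar), le_rfl⟩

theorem Runs.flip {a : I} {e : IExp I} (hΓ : ∀ v, Γ a v)
    (hU : ∀ σ : Mem I R, (∀ a, Γ a (σ.int a 0)) → U (Sum.inl (a, e.eval σ))) :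
    Runs U Γ (.flip a e : Cmd I R) (e.cost + 1) :=
  fun σ hσ => ⟨⟨(hσ.setInt (fun _ => hΓ (if σ.tape σ.pos then 1 else 0))
      (hU σ hσ.scalar)).scalar, (hσ.setInt (fun _ => hΓ (if σ.tape σ.pos then 1 else 0))
      (hU σ hσ.scalar)).used⟩, le_rfl⟩

/-- Both branches are charged; the maximum would do, but sums keep the resulting bounds polynomial.
-/
theorem Runs.ite {b : Cond I R} {c c' : Cmd I R} {B B' : ℕ} (h : Runs U Γ c B)
    (h' : Runs U Γ c' B') : Runs U Γ (.ite b c c') (b.cost + (B + B')) := fun σ hσ => by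
  by_cases hb : b.eval σ
  · simp only [Cmd.exec, Cmd.cost, hb, if_true]
    exact ⟨(h σ hσ).1, by have := (h σ hσ).2; omega⟩
  · simp only [Cmd.exec, Cmd.cost, hb, if_false]
    exact ⟨(h' σ hσ).1, by have := (h' σ hσ).2; omega⟩

/-- Inside the body the counter is known to be below `N`, which is what bounds array indices there,
so the body is checked against `Γ` strengthened at `a`. Outside, `Γ` must allow any value of `a`, so
that setting the counter and forgetting its bound are both harmless. -/
theorem Runs.loop {a : I} {e : IExp I} {c : Cmd I R} {B N : ℕ} (hΓ : ∀ v, Γ a v)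
    (hU : U (Sum.inl (a, 0)))
    (hN : ∀ σ : Mem I R, (∀ a, Γ a (σ.int a 0)) → e.eval σ = N)
    (h : Runs U (Function.update Γ a (· < N)) c B) :
    Runs U Γ (.loop a e c) (e.cost + 1 + N * (B + 1)) := fun σ hσ => by
  have hup : ∀ τ : Mem I R, ∀ k < N, Typed U Γ τ →
      Typed U (Function.update Γ a (· < N)) (τ.setInt a 0 k) := fun τ k hk hτ => by
    have h0 := hτ.setInt (v := k) (fun _ => hΓ k) hU
    refine ⟨fun b => ?_, h0.used⟩
    by_cases hb : b = a
    · subst hb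
      simpa [Mem.setInt] using hk
    · rw [Function.update_of_ne hb]
      exact h0.scalar b
  have hdown : ∀ τ : Mem I R, Typed U (Function.update Γ a (· < N)) τ → Typed U Γ τ :=
    fun τ hτ => ⟨fun b => by
      by_cases hb : b = a
      · subst hb
        exact hΓ _
      · simpa [Function.update_of_ne hb] using hτ.scalar b, hτ.used⟩
  have hit : ∀ k ≤ N, Typed U Γ (iterate a c.exec σ k) := fun k => by
    induction k with
    | zero => exact fun _ => hσ
    | succ k ih => exact fun hk => hdown _ (h _ (hup _ k hk (ih (by omega)))).1
  simp only [Cmd.exec, Cmd.cost, hN σ hσ.scalar]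
  refine ⟨hit N le_rfl, ?_⟩
  have : ∑ k ∈ Finset.range N, (c.cost ((iterate a c.exec σ k).setInt a 0 k) + 1) ≤
      ∑ k ∈ Finset.range N, (B + 1) := Finset.sum_le_sum fun k hk => by
    have hk := Finset.mem_range.1 hk
    have := (h _ (hup _ k hk (hit k hk.le))).2
    omega
  simpa using this

end RealRAM

/-! ### Cells and running times of the individual programs. -/

namespace FastGreedy

open RealRAM OnlineMatching

/-- The sizes of the integer arrays. -/
def intSize (n : ℕ) : IName → ℕ
  | .dl | .flag | .m => n
  | _ => 1

/-- The sizes of the real arrays. -/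
def realSize (n d s : ℕ) : RName → ℕ
  | .x => n * d
  | .xs => n * s
  | .M => s * d
  | .w | .ws => n
  | .y => d
  | .ys => s
  | _ => 1

/-- The cells of the data structure. -/
def IsCell (n d s : ℕ) : IName × ℕ ⊕ RName × ℕ → Prop
  | .inl (a, k) => k < intSize n a
  | .inr (a, k) => k < realSize n d s a

/-- The invariant of the scalar integer variables. -/
def scalarInv (n d s : ℕ) : IName → ℕ → Prop
  | .n, v => v = n
  | .d, v => v = d
  | .s, v => v = s
  | .best, v => v < n
  | _, _ => True

theorem mul_add_lt_mul {a b m k : ℕ} (ha : a < m) (hb : b < k) : a * k + b < m * k :=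
  calc a * k + b < a * k + k := by omega
    _ = (a + 1) * k := by ring
    _ ≤ m * k := Nat.mul_le_mul_right k ha

theorem eval_idx_lt {σ : Memory} {a b len : IName} {m k : ℕ} (ha : σ.int a 0 < m)
    (hb : σ.int b 0 < k) (hl : σ.int len 0 = k) : (idx a len b).eval σ < m * k := by
  simp only [idx, ivar, IExp.eval, hl]
  exact mul_add_lt_mul ha hb

/-- The derivation mirrors the syntax of the program. Its side goals say that loop bounds are `n`,
`d` or `s` and that written indices lie inside their arrays. -/
theorem runs_query (n d s : ℕ) :
    Runs (IsCell n d s) (scalarInv n d s) query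
      (100 * (s * d + n * s + s + n + 1)) := by
  unfold query
  refine Runs.mono (Runs.cons (Runs.loop (N := s) ?_ ?_ ?_ (Runs.cons (Runs.setReal ?_)
      (Runs.cons (Runs.loop (N := d) ?_ ?_ ?_ (Runs.setReal ?_)) Runs.nil)))
      (Runs.cons (Runs.loop (N := n) ?_ ?_ ?_ (Runs.cons (Runs.setReal ?_)
        (Runs.cons (Runs.loop (N := s) ?_ ?_ ?_ (Runs.setReal ?_))
          (Runs.cons (Runs.setReal ?_) Runs.nil)))) Runs.nil)) ?_
  all_goals first
    | exact fun _ => trivial | exact Nat.one_pos | exact fun _ _ => Nat.one_pos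
    | exact fun σ h => h .n | exact fun σ h => h .d | exact fun σ h => h .s
    | exact fun σ h => h .i | exact fun σ h => h .j | exact fun σ h => h .k
    | exact fun σ h => h .best | exact fun _ _ => trivial
    | exact fun σ h => eval_idx_lt (h .i) (h .k) (h .s)
    | skip
  simp only [IExp.cost, RExp.cost, ivar, rvar, idx]
  nlinarith [Nat.zero_le (s * d), Nat.zero_le (n * s)]

theorem runs_search (n d s : ℕ) :
    Runs (IsCell n d s) (scalarInv n d s) search (100 * (n + 1)) := by
  unfold search
  refine Runs.mono (Runs.cons (Runs.setInt ?_ ?_) (Runs.cons (Runs.loop (N := n) ?_ ?_ ?_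
    (Runs.ite (Runs.ite
      (Runs.cons (Runs.setInt ?_ ?_) (Runs.cons (Runs.setInt ?_ ?_) Runs.nil))
      (Runs.ite (Runs.setInt ?_ ?_) Runs.skip)) Runs.skip)) Runs.nil)) ?_
  all_goals first
    | exact fun _ => trivial | exact Nat.one_pos | exact fun _ _ => Nat.one_pos
    | exact fun σ h => h .n | exact fun σ h => h .d | exact fun σ h => h .s
    | exact fun σ h => h .i | exact fun σ h => h .j | exact fun σ h => h .k
    | exact fun σ h => h .best | exact fun _ _ => trivial
    | exact fun σ h => eval_idx_lt (h .i) (h .k) (h .s)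
    | skip
  simp only [IExp.cost, RExp.cost, Cond.cost, ivar]
  omega

theorem runs_update (n d s : ℕ) :
    Runs (IsCell n d s) (scalarInv n d s) update (400 * (s * d + n * s + s + n + 1)) := by
  unfold update
  refine Runs.mono (Runs.cons (Runs.setInt ?_ ?_) (Runs.cons (Runs.loop (N := n) ?_ ?_ ?_
    (Runs.ite (Runs.setInt ?_ ?_) Runs.skip)) (Runs.cons (Runs.loop (N := n) ?_ ?_ ?_
    (Runs.ite (Runs.setInt ?_ ?_) Runs.skip)) (Runs.cons (Runs.ite (Runs.cons (runs_query n d s)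
    (Runs.cons (runs_search n d s) (Runs.cons (Runs.ite (Runs.ite
      (Runs.cons (Runs.setInt ?_ ?_) (Runs.cons (Runs.setReal ?_) (Runs.cons (Runs.setReal ?_)
      Runs.nil))) Runs.skip) Runs.skip) Runs.nil))) Runs.skip) Runs.nil)))) ?_
  all_goals first
    | exact fun _ => trivial | exact Nat.one_pos | exact fun _ _ => Nat.one_pos
    | exact fun σ h => h .n | exact fun σ h => h .d | exact fun σ h => h .s
    | exact fun σ h => h .i | exact fun σ h => h .j | exact fun σ h => h .k
    | exact fun σ h => h .best | exact fun _ _ => trivial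
    | exact fun σ h => eval_idx_lt (h .i) (h .k) (h .s)
    | skip
  simp only [IExp.cost, RExp.cost, Cond.cost, ivar, rvar]
  omega

theorem runs_totalWeight (n d s : ℕ) :
    Runs (IsCell n d s) (scalarInv n d s) totalWeight 10 := by
  unfold totalWeight
  refine Runs.mono (Runs.setReal ?_) ?_
  · exact fun _ _ => Nat.one_pos
  · simp [IExp.cost, RExp.cost, rvar]

/-- Sampling the sketching matrix. -/
def sample : Program :=
  .loop .i (ivar .s) <| .loop .j (ivar .d) <| block
    [.flip .bit (.const 0),
     .ite (.intEq (ivar .bit) (.const 1))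
       (.setReal .M (idx .i .d .j)
         (.div (.ofInt (.const 1)) (.sqrt (.ofInt (ivar .s)))))
       (.setReal .M (idx .i .d .j)
         (.sub (.ofInt (.const 0)) (.div (.ofInt (.const 1)) (.sqrt (.ofInt (ivar .s))))))]

/-- Sketching the sellers. -/
def sketch : Program :=
  .loop .i (ivar .n) <| block
    [.setReal .w (ivar .i) (.ofInt (.const 0)),
     .setInt .flag (ivar .i) (.const 1),
     .setInt .m (ivar .i) (.const 0),
     .loop .k (ivar .s) <| block
       [.setReal .xs (idx .i .s .k) (.ofInt (.const 0)),
        .loop .j (ivar .d) <|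
          .setReal .xs (idx .i .s .k)
            (.add (.get .xs (idx .i .s .k))
              (.mul (.get .M (idx .k .d .j)) (.get .x (idx .i .d .j))))]]

theorem runs_sample (n d s : ℕ) :
    Runs (IsCell n d s) (scalarInv n d s) sample (100 * (s * d + s + 1)) := by
  unfold sample
  refine Runs.mono (Runs.loop (N := s) ?_ ?_ ?_ (Runs.loop (N := d) ?_ ?_ ?_ (Runs.cons
    (Runs.flip ?_ ?_) (Runs.cons (Runs.ite (Runs.setReal ?_) (Runs.setReal ?_)) Runs.nil)))) ?_
  all_goals first
    | exact fun _ => trivial | exact Nat.one_pos | exact fun _ _ => Nat.one_pos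
    | exact fun σ h => h .n | exact fun σ h => h .d | exact fun σ h => h .s
    | exact fun σ h => h .i | exact fun σ h => h .j | exact fun σ h => h .k
    | exact fun σ h => h .best | exact fun _ _ => trivial
    | exact fun σ h => eval_idx_lt (h .i) (h .j) (h .d)
    | skip
  simp only [IExp.cost, RExp.cost, Cond.cost, ivar, idx]
  nlinarith [Nat.zero_le (s * d)]

theorem runs_sketch (n d s : ℕ) :
    Runs (IsCell n d s) (scalarInv n d s) sketch (100 * (n * s * d + n * s + n + 1)) := by
  unfold sketch
  refine Runs.mono (Runs.loop (N := n) ?_ ?_ ?_ (Runs.cons (Runs.setReal ?_) (Runs.cons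
    (Runs.setInt ?_ ?_) (Runs.cons (Runs.setInt ?_ ?_) (Runs.cons (Runs.loop (N := s) ?_ ?_ ?_
    (Runs.cons (Runs.setReal ?_) (Runs.cons (Runs.loop (N := d) ?_ ?_ ?_ (Runs.setReal ?_))
    Runs.nil))) Runs.nil))))) ?_
  all_goals first
    | exact fun _ => trivial | exact Nat.one_pos | exact fun _ _ => Nat.one_pos
    | exact fun σ h => h .n | exact fun σ h => h .d | exact fun σ h => h .s
    | exact fun σ h => h .i | exact fun σ h => h .j | exact fun σ h => h .k
    | exact fun σ h => h .best | exact fun _ _ => trivial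
    | exact fun σ h => eval_idx_lt (h .i) (h .k) (h .s)
    | skip
  simp only [IExp.cost, RExp.cost, ivar, idx]
  nlinarith [Nat.zero_le (n * s), Nat.zero_le (n * s * d)]

end FastGreedy

/-! ### Resource bounds for initialization and for sequences of calls. -/

namespace FastGreedy

open RealRAM OnlineMatching

variable {n d : ℕ}

/-- The number of rows of the sketching matrix. -/
noncomputable def rows (C : ℕ) (ε δ : ℝ) (n : ℕ) : ℕ :=
  ⌈(C : ℝ) / (ε * ε) * Real.log (n / δ)⌉₊

/-- The memory before the matrix is sampled. -/
noncomputable def sampleInput (C : ℕ) (ε δ : ℝ) (x : Fin n → EuclideanSpace ℝ (Fin d))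
    (dl : Fin n → ℕ) (ω : ℕ → Bool) : Memory :=
  (((initInput ε δ x dl ω).setReal .p 0 0).setInt .time 0 0).setInt .s 0 (rows C ε δ n)

/-- The initialization up to the choice of the number of rows. -/
def initWith (C : ℕ) (P Q : Program) : Program := block
  [.setReal .p (.const 0) (.ofInt (.const 0)),
   .setInt .time (.const 0) (.const 0),
   .ceil .s (.const 0)
     (.mul (.div (.ofInt (.const C)) (.mul (rvar .eps) (rvar .eps)))
       (.log (.div (.ofInt (ivar .n)) (rvar .delta)))),
   P, Q]

/-- With `P` and `Q` opaque, only the straight-line prefix is unfolded; sampling and sketching are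
substituted afterwards, where `init` agrees by definition. -/
theorem initWith_exec (C : ℕ) (ε δ : ℝ) (x : Fin n → EuclideanSpace ℝ (Fin d))
    (dl : Fin n → ℕ) (ω : ℕ → Bool) (P Q : Program) :
    (initWith C P Q).exec (initInput ε δ x dl ω) =
      Q.exec (P.exec (sampleInput C ε δ x dl ω)) := by
  simp only [initWith, block, Cmd.exec, IExp.eval, RExp.eval, rvar, ivar, sampleInput,
    rows, Nat.cast_zero]
  rfl

theorem initWith_cost (C : ℕ) (ε δ : ℝ) (x : Fin n → EuclideanSpace ℝ (Fin d))
    (dl : Fin n → ℕ) (ω : ℕ → Bool) (P Q : Program) :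
    (initWith C P Q).cost (initInput ε δ x dl ω) =
      25 + rows C ε δ n + P.cost (sampleInput C ε δ x dl ω) +
      Q.cost (P.exec (sampleInput C ε δ x dl ω)) := by
  -- The prefix costs 4 for `p`, 3 for `time`, and 18 plus the value rounded to for `s`.
  have h : ∀ a b c : ℕ, 25 + a + b + c = 4 + (3 + (18 + a + (b + (c + 0)))) := by
    intros; omega
  rw [h]
  simp only [initWith, block, Cmd.cost, Cmd.exec, sampleInput,
    rows, Nat.cast_zero, IExp.eval, RExp.eval, rvar, ivar, IExp.cost, RExp.cost]
  rfl

theorem init_exec (C : ℕ) (ε δ : ℝ) (x : Fin n → EuclideanSpace ℝ (Fin d))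
    (dl : Fin n → ℕ) (ω : ℕ → Bool) :
    (init C).exec (initInput ε δ x dl ω) =
      sketch.exec (sample.exec (sampleInput C ε δ x dl ω)) :=
  initWith_exec C ε δ x dl ω sample sketch

theorem initTime_eq (C : ℕ) (ε δ : ℝ) (x : Fin n → EuclideanSpace ℝ (Fin d))
    (dl : Fin n → ℕ) (ω : ℕ → Bool) :
    initTime C ε δ x dl ω = 25 + rows C ε δ n + sample.cost (sampleInput C ε δ x dl ω) +
      sketch.cost (sample.exec (sampleInput C ε δ x dl ω)) :=
  initWith_cost C ε δ x dl ω sample sketch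

/-- The scalar invariant may fail until `n`, `d` and `s` are written, so the cells are tracked with
the trivial invariant and the scalars are evaluated at the end. Positivity of `n` is needed for
`best`, which starts at `0` and must be an index below `n`. -/
theorem typed_sampleInput (C : ℕ) (ε δ : ℝ) (x : Fin n → EuclideanSpace ℝ (Fin d))
    (dl : Fin n → ℕ) (ω : ℕ → Bool) (hn : 0 < n) :
    Typed (IsCell n d (rows C ε δ n)) (scalarInv n d (rows C ε δ n))
      (sampleInput C ε δ x dl ω) := by
  set s := rows C ε δ n
  have h0 : Typed (IsCell n d s) (fun _ _ => True) (sampleInput C ε δ x dl ω) := by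
    refine .setInt (.setInt (.setReal (.loadInt (.loadReal (.setReal (.setReal (.setInt (.setInt
      ⟨fun _ => trivial, ?_⟩ ?_ ?_) ?_ ?_) _ ?_) _ ?_) _ ?_) _ ?_ ?_) _ ?_) ?_ ?_) ?_ ?_
    all_goals first
      | exact fun _ => trivial | exact Nat.one_pos | exact fun _ h => h
      | exact fun _ h => absurd h (Finset.notMem_empty _)
  refine ⟨fun a => ?_, h0.used⟩
  cases a <;> simp [scalarInv, sampleInput, initInput, Mem.setInt, Mem.setReal, Mem.loadInt,
    Mem.loadReal, Mem.blank, hn, s]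

theorem typed_load {s : ℕ} {σ : Memory} (h : Typed (IsCell n d s) (scalarInv n d s) σ)
    (c : Call n d) : Typed (IsCell n d s) (scalarInv n d s) (c.load σ) := by
  match c with
  | .update (.seller i) => exact h.setInt (fun _ => trivial) Nat.one_pos
  | .update (.buyer y) =>
    exact (h.setInt (a := .who) (k := 0) (v := 0) (fun _ => trivial) Nat.one_pos).loadReal _ fun _ hk => hk
  | .query y => exact h.loadReal _ fun _ hk => hk
  | .totalWeight => exact h

theorem typed_run {s : ℕ} {σ : Memory} (h : Typed (IsCell n d s) (scalarInv n d s) σ)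
    (c : Call n d) : Typed (IsCell n d s) (scalarInv n d s) (c.run σ) := by
  have hl := typed_load h c
  match c with
  | .update a => exact (runs_update n d s _ hl).1
  | .query y => exact (runs_query n d s _ hl).1
  | .totalWeight => exact (runs_totalWeight n d s _ hl).1

theorem state_concat (C : ℕ) (ε δ : ℝ) (x : Fin n → EuclideanSpace ℝ (Fin d)) (dl : Fin n → ℕ)
    (calls : List (Call n d)) (c : Call n d) (ω : ℕ → Bool) :
    state C ε δ x dl (calls ++ [c]) ω = c.run (state C ε δ x dl calls ω) := by
  simp [state]

theorem typed_state (C : ℕ) (ε δ : ℝ) (x : Fin n → EuclideanSpace ℝ (Fin d))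
    (dl : Fin n → ℕ) (calls : List (Call n d)) (ω : ℕ → Bool) (hn : 0 < n) :
    Typed (IsCell n d (rows C ε δ n)) (scalarInv n d (rows C ε δ n))
      (state C ε δ x dl calls ω) := by
  induction calls using List.reverseRecOn with
  | nil =>
    simp only [state, List.foldl_nil, init_exec]
    exact (runs_sketch n d _ _ (runs_sample n d _ _ (typed_sampleInput C ε δ x dl ω hn)).1).1
  | append_singleton calls c ih =>
    rw [state_concat]
    exact typed_run ih c

theorem initTime_le (C : ℕ) (ε δ : ℝ) (x : Fin n → EuclideanSpace ℝ (Fin d))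
    (dl : Fin n → ℕ) (ω : ℕ → Bool) (hn : 0 < n) :
    initTime C ε δ x dl ω ≤ 25 + rows C ε δ n + 100 * (rows C ε δ n * d + rows C ε δ n + 1) +
      100 * (n * rows C ε δ n * d + n * rows C ε δ n + n + 1) := by
  have h := runs_sample n d _ _ (typed_sampleInput C ε δ x dl ω hn)
  have h' := runs_sketch n d _ _ h.1
  rw [initTime_eq]
  have := h.2
  have := h'.2
  omega

/-- All used cells lie in finitely many arrays of known sizes. The summand `3 * n + 11` counts the
integer cells, the rest the real ones. -/
theorem space_le {s : ℕ} {σ : Memory} (h : Typed (IsCell n d s) (scalarInv n d s) σ) :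
    σ.space ≤ 3 * n + 11 + (n * d + n * s + s * d + 2 * n + d + s + 5) := by
  have hsub : σ.used ⊆
      (({.n, .d, .s, .dl, .flag, .m, .time, .who, .i, .j, .k, .bit, .found, .best} :
        Finset IName).biUnion fun a => (Finset.range (intSize n a)).image fun k => .inl (a, k)) ∪
      (({.eps, .delta, .x, .xs, .M, .w, .p, .y, .ys, .acc, .ws, .out} :
        Finset RName).biUnion fun a =>
          (Finset.range (realSize n d s a)).image fun k => .inr (a, k)) := by
    intro c hc
    have hcell := h.used c hc
    match c with
    | .inl (a, k) =>
      refine Finset.mem_union_left _ (Finset.mem_biUnion.2 ⟨a, ?_, Finset.mem_image.2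
        ⟨k, Finset.mem_range.2 hcell, rfl⟩⟩)
      cases a <;> decide
    | .inr (a, k) =>
      refine Finset.mem_union_right _ (Finset.mem_biUnion.2 ⟨a, ?_, Finset.mem_image.2
        ⟨k, Finset.mem_range.2 hcell, rfl⟩⟩)
      cases a <;> decide
  refine (Finset.card_le_card hsub).trans ((Finset.card_union_le _ _).trans ?_)
  gcongr
  · refine Finset.card_biUnion_le.trans ((Finset.sum_le_sum fun a _ =>
      Finset.card_image_le.trans_eq (Finset.card_range _)).trans (le_of_eq ?_))
    simp [intSize]
    ring
  · refine Finset.card_biUnion_le.trans ((Finset.sum_le_sum fun a _ =>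
      Finset.card_image_le.trans_eq (Finset.card_range _)).trans (le_of_eq ?_))
    simp [realSize]
    ring

/-- The parameter `ε⁻² log (n / δ)` is bounded below, and bounds the number of rows. -/
theorem rows_bounds {C : ℕ} (hC : 0 < C) {ε δ : ℝ} (hε : 0 < ε) (hε1 : ε < 1) (hδ : 0 < δ)
    (hn : 2 * δ ≤ n) :
    1 / 2 ≤ (ε ^ 2)⁻¹ * Real.log (n / δ) ∧
    (rows C ε δ n : ℝ) ≤ (C + 2) * ((ε ^ 2)⁻¹ * Real.log (n / δ)) ∧
    C * ((ε ^ 2)⁻¹ * Real.log (n / δ)) ≤ rows C ε δ n ∧ 0 < rows C ε δ n := by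
  have h2 : (2 : ℝ) ≤ n / δ := by rwa [le_div_iff₀ hδ]
  have hlog : 1 / 2 ≤ Real.log (n / δ) := by
    have := Real.log_le_log two_pos h2
    have := Real.log_two_gt_d9
    linarith
  have hinv : 1 ≤ (ε ^ 2)⁻¹ := (one_le_inv₀ (by positivity)).2 (by nlinarith)
  have hL : 1 / 2 ≤ (ε ^ 2)⁻¹ * Real.log (n / δ) := by nlinarith
  have e : (C : ℝ) / (ε * ε) * Real.log (n / δ) = C * ((ε ^ 2)⁻¹ * Real.log (n / δ)) := by
    rw [sq]; ring
  have hC' : (0 : ℝ) < C := by exact_mod_cast hC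
  have hpos : 0 < (C : ℝ) * ((ε ^ 2)⁻¹ * Real.log (n / δ)) := by
    apply mul_pos hC'; linarith
  unfold rows
  rw [e]
  refine ⟨hL, ?_, Nat.le_ceil _, Nat.ceil_pos.2 hpos⟩
  have := Nat.ceil_lt_add_one hpos.le
  linarith

end FastGreedy

/-! ### Frames and loop invariants for the values computed. -/

namespace RealRAM

variable {I R : Type}

/-- The integer arrays that a command may modify. -/
def Cmd.intVars : Cmd I R → List I
  | .skip => []
  | .seq c c' => c.intVars ++ c'.intVars
  | .setInt a _ _ => [a]
  | .setReal _ _ _ => []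
  | .ceil a _ _ => [a]
  | .flip a _ => [a]
  | .ite _ c c' => c.intVars ++ c'.intVars
  | .loop a _ c => a :: c.intVars

/-- The real arrays that a command may modify. -/
def Cmd.realVars : Cmd I R → List R
  | .skip => []
  | .seq c c' => c.realVars ++ c'.realVars
  | .setInt _ _ _ => []
  | .setReal a _ _ => [a]
  | .ceil _ _ _ => []
  | .flip _ _ => []
  | .ite _ c c' => c.realVars ++ c'.realVars
  | .loop _ _ c => c.realVars

/-- The memories differ at most in the integer arrays `V` and in the real arrays `W`. -/
structure Frame (V : List I) (W : List R) (σ τ : Mem I R) : Prop where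
  int : ∀ a ∉ V, τ.int a = σ.int a
  real : ∀ a ∉ W, τ.real a = σ.real a
  tape : τ.tape = σ.tape

theorem Frame.refl (V : List I) (W : List R) (σ : Mem I R) : Frame V W σ σ :=
  ⟨fun _ _ => rfl, fun _ _ => rfl, rfl⟩

theorem Frame.trans {V : List I} {W : List R} {σ τ υ : Mem I R} (h : Frame V W σ τ)
    (h' : Frame V W τ υ) : Frame V W σ υ :=
  ⟨fun a ha => (h'.int a ha).trans (h.int a ha), fun a ha => (h'.real a ha).trans (h.real a ha),
    h'.tape.trans h.tape⟩

theorem Frame.mono {V V' : List I} {W W' : List R} {σ τ : Mem I R} (h : Frame V W σ τ)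
    (hV : V ⊆ V') (hW : W ⊆ W') : Frame V' W' σ τ :=
  ⟨fun a ha => h.int a fun h => ha (hV h), fun a ha => h.real a fun h => ha (hW h), h.tape⟩

variable [DecidableEq I] [DecidableEq R]

theorem Mem.int_setInt_of_ne {σ : Mem I R} {a b : I} (k v : ℕ) (h : b ≠ a) :
    (σ.setInt a k v).int b = σ.int b := by
  ext l; simp [Mem.setInt, h]

theorem Mem.real_setReal_of_ne {σ : Mem I R} {a b : R} (k : ℕ) (v : ℝ) (h : b ≠ a) :
    (σ.setReal a k v).real b = σ.real b := by
  ext l; simp [Mem.setReal, h]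

theorem frame_setInt (σ : Mem I R) (a : I) (k v : ℕ) : Frame [a] [] σ (σ.setInt a k v) :=
  ⟨fun _ hb => Mem.int_setInt_of_ne k v fun h => hb (by simp [h]), fun _ _ => rfl, rfl⟩

theorem frame_setReal (σ : Mem I R) (a : R) (k : ℕ) (v : ℝ) : Frame [] [a] σ (σ.setReal a k v) :=
  ⟨fun _ _ => rfl, fun _ hb => Mem.real_setReal_of_ne k v fun h => hb (by simp [h]), rfl⟩

theorem frame_iterate {V : List I} {W : List R} (a : I) (c : Cmd I R)
    (h : ∀ σ, Frame V W σ (c.exec σ)) (σ : Mem I R) (k : ℕ) :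
    Frame (a :: V) W σ (iterate a c.exec σ k) := by
  induction k with
  | zero => exact .refl _ _ _
  | succ k ih =>
    refine ih.trans (((frame_setInt _ a 0 k).mono (by simp) (by simp)).trans
      ((h _).mono (by simp) (by simp)))

/-- For a concrete program this makes "this array is unchanged" decidable by inspecting syntax.
Nothing is claimed about `pos` and `used`. -/
theorem frame_exec (c : Cmd I R) (σ : Mem I R) : Frame c.intVars c.realVars σ (c.exec σ) := by
  induction c generalizing σ with
  | skip => exact .refl _ _ _
  | seq c c' h h' =>
    exact ((h σ).mono (by simp [Cmd.intVars]) (by simp [Cmd.realVars])).trans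
      ((h' _).mono (by simp [Cmd.intVars]) (by simp [Cmd.realVars]))
  | setInt a e f => exact frame_setInt _ _ _ _
  | setReal a e f => exact frame_setReal _ _ _ _
  | ceil a e f => exact frame_setInt _ _ _ _
  | flip a e =>
    exact ⟨(frame_setInt σ a (e.eval σ) (if σ.tape σ.pos then 1 else 0)).int, fun _ _ => rfl, rfl⟩
  | ite b c c' h h' =>
    by_cases hb : b.eval σ
    · simp only [Cmd.exec, hb, if_true]
      exact (h σ).mono (by simp [Cmd.intVars]) (by simp [Cmd.realVars])
    · simp only [Cmd.exec, hb, if_false]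
      exact (h' σ).mono (by simp [Cmd.intVars]) (by simp [Cmd.realVars])
  | loop a e c h => exact frame_iterate a c h σ _

/-- Loop invariants. -/
theorem exec_loop_induct {a : I} {e : IExp I} {c : Cmd I R} {σ : Mem I R} {N : ℕ}
    (hN : e.eval σ = N) (P : ℕ → Mem I R → Prop) (h0 : P 0 σ)
    (hs : ∀ k < N, ∀ τ, Frame (a :: c.intVars) c.realVars σ τ → τ.int a 0 = k →
      (∀ υ, τ = υ.setInt a 0 k → P k υ → P (k + 1) (c.exec τ))) :
    P N ((Cmd.loop a e c).exec σ) := by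
  have h : ∀ k ≤ N, P k (iterate a c.exec σ k) := fun k => by
    induction k with
    | zero => exact fun _ => h0
    | succ k ih =>
      intro hk
      refine hs k hk _ ?_ (by simp [Mem.setInt]) _ rfl (ih (by omega))
      exact (frame_iterate a c (frame_exec c) σ k).trans
        ((frame_setInt _ a 0 k).mono (by simp) (by simp))
  simpa only [Cmd.exec, hN] using h N le_rfl

/-- The loop changes only the counter and `r`, so it is enough to know `ι` and `f` in memories that
differ from `σ` there. The second conjunct is needed because frames cannot distinguish entries of
one array. -/
theorem exec_accumulate {a : I} {e ι : IExp I} {r : R} {f : RExp I R} {σ : Mem I R} {N p : ℕ}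
    (g : ℕ → ℝ) (hN : e.eval σ = N) (hι : ∀ τ, Frame [a] [r] σ τ → ι.eval τ = p)
    (hf : ∀ k < N, ∀ τ, Frame [a] [r] σ τ → τ.int a 0 = k → f.eval τ = g k) :
    ((Cmd.loop a e (.setReal r ι (.add (.get r ι) f))).exec σ).real r p =
        σ.real r p + ∑ k ∈ Finset.range N, g k ∧
      ∀ l ≠ p, ((Cmd.loop a e (.setReal r ι (.add (.get r ι) f))).exec σ).real r l =
        σ.real r l := by
  refine exec_loop_induct hN (fun k τ => τ.real r p = σ.real r p + ∑ k ∈ Finset.range k, g k ∧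
    ∀ l ≠ p, τ.real r l = σ.real r l) (by simp) fun k hk τ hτ hk' υ hυ hP => ?_
  have h1 := hι τ hτ
  have h2 := hf k hk τ hτ hk'
  have hr : τ.real = υ.real := by rw [hυ]; rfl
  constructor
  · simp [Cmd.exec, RExp.eval, Mem.setReal, h1, h2, hr, hP.1, Finset.sum_range_succ, add_assoc]
  · intro l hl
    simp [Cmd.exec, Mem.setReal, h1, hl, hr, hP.2 l hl]

/-- `r[ι] ← ∑ a < e, f`. -/
def sumLoop (a : I) (e ι : IExp I) (r : R) (f : RExp I R) : List (Cmd I R) :=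
  [.setReal r ι (.ofInt (.const 0)), .loop a e (.setReal r ι (.add (.get r ι) f))]

/-- The memory after the summation is hidden behind `τ`, so callers reason from its frame and its
`r`-entries while `cs` remains to be run. -/
theorem exec_sumLoop {a : I} {e ι : IExp I} {r : R} {f : RExp I R} {cs : List (Cmd I R)}
    {σ : Mem I R} {N p : ℕ}
    (g : ℕ → ℝ) (hN : ∀ τ, Frame [] [r] σ τ → e.eval τ = N)
    (hι : ∀ τ, Frame [a] [r] σ τ → ι.eval τ = p)
    (hf : ∀ k < N, ∀ τ, Frame [a] [r] σ τ → τ.int a 0 = k → f.eval τ = g k) :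
    ∃ τ, (block (sumLoop a e ι r f ++ cs)).exec σ = (block cs).exec τ ∧ Frame [a] [r] σ τ ∧
      τ.real r p = ∑ k ∈ Finset.range N, g k ∧ ∀ l ≠ p, τ.real r l = σ.real r l := by
  have hfr : Frame [a] [r] σ (σ.setReal r p 0) := (frame_setReal σ r p 0).mono (by simp) (by simp)
  have h := exec_accumulate (σ := σ.setReal r p 0) g (hN _ (frame_setReal σ r p 0))
    (fun τ hτ => hι τ (hfr.trans hτ)) (fun k hk τ hτ => hf k hk τ (hfr.trans hτ))
  refine ⟨_, ?_, hfr.trans (frame_exec (Cmd.loop a e (.setReal r ι (.add (.get r ι) f))) _),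
    ?_, fun l hl => ?_⟩
  · simp only [sumLoop, List.cons_append, List.nil_append, block, Cmd.exec, RExp.eval, IExp.eval,
      Nat.cast_zero, hι σ (.refl _ _ _)]
  · rw [h.1]
    simp [Mem.setReal]
  · rw [h.2 l hl]
    simp [Mem.setReal, hl]

end RealRAM

/-! ### The values computed by a query. -/

namespace FastGreedy

open RealRAM OnlineMatching

/-- The product of row `k` of a matrix with `d` columns and row `i` of another one, both stored row
by row. -/
noncomputable def rowMul (M v : ℕ → ℝ) (d k i : ℕ) : ℝ :=
  ∑ j ∈ Finset.range d, M (k * d + j) * v (i * d + j)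

/-- Sketching the query point. -/
def sketchPoint : Program :=
  .loop .k (ivar .s) <| block <| sumLoop .j (ivar .d) (ivar .k) .ys
    (.mul (.get .M (idx .k .d .j)) (.get .y (ivar .j)))

/-- The query point is treated as a matrix with a single row, hence the row index `0`; this gives it
the same formula as the sellers. -/
theorem sketchPoint_exec (σ : Memory) : ∀ k < σ.int .s 0,
    (sketchPoint.exec σ).real .ys k = rowMul (σ.real .M) (σ.real .y) (σ.int .d 0) k 0 := by
  refine exec_loop_induct (N := σ.int .s 0) rfl (fun K (τ : Memory) => ∀ k < K, τ.real .ys k =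
    rowMul (σ.real .M) (σ.real .y) (σ.int .d 0) k 0) (by simp) fun K hK τ hτ hK' υ hυ hP => ?_
  have hM : τ.real .M = σ.real .M := hτ.real _ (by decide)
  have hy : τ.real .y = σ.real .y := hτ.real _ (by decide)
  have hd : τ.int .d = σ.int .d := hτ.int _ (by decide)
  have hr : τ.real = υ.real := by rw [hυ]; rfl
  obtain ⟨ρ, hρ, hfr, h1, h2⟩ := exec_sumLoop (a := .j) (e := ivar .d) (ι := ivar .k)
    (r := RName.ys) (f := .mul (.get .M (idx .k .d .j)) (.get .y (ivar .j))) (cs := [])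
    (σ := τ) (N := σ.int .d 0) (p := K)
    (fun j => σ.real .M (K * σ.int .d 0 + j) * σ.real .y (0 * σ.int .d 0 + j))
    (fun ρ hρ => (by
      have : ρ.int .d = τ.int .d := hρ.int _ (by decide)
      simp [IExp.eval, ivar, this, hd]))
    (fun ρ hρ => by
      have : ρ.int .k = τ.int .k := hρ.int _ (by decide)
      simp [IExp.eval, ivar, this, hK'])
    (fun j hj ρ hρ hj' => by
      have h1 : ρ.int .k = τ.int .k := hρ.int _ (by decide)
      have h2 : ρ.int .d = τ.int .d := hρ.int _ (by decide)
      have h3 : ρ.real .M = τ.real .M := hρ.real _ (by decide)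
      have h4 : ρ.real .y = τ.real .y := hρ.real _ (by decide)
      simp [IExp.eval, RExp.eval, ivar, idx, h1, h2, h3, h4, hK', hj', hM, hy, hd])
  rw [List.append_nil] at hρ
  rw [hρ]
  intro k hk
  by_cases hkK : k = K
  · subst hkK
    exact h1
  · rw [show (Cmd.exec (block []) ρ) = ρ from rfl, h2 k hkK, hr]
    exact hP k (by omega)

/-- Comparing the sketch of the query point with those of the sellers. -/
def sketchDist : Program :=
  .loop .i (ivar .n) <| block <| sumLoop .k (ivar .s) (.const 0) .acc
    (.mul (.sub (.get .ys (ivar .k)) (.get .xs (idx .i .s .k)))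
      (.sub (.get .ys (ivar .k)) (.get .xs (idx .i .s .k)))) ++
    [.setReal .ws (ivar .i) (.sqrt (rvar .acc))]

/-- The distance between a vector `v` and row `i` of a matrix with `s` columns. -/
noncomputable def rowDist (v xs : ℕ → ℝ) (s i : ℕ) : ℝ :=
  Real.sqrt (∑ k ∈ Finset.range s, (v k - xs (i * s + k)) * (v k - xs (i * s + k)))

theorem sketchDist_exec (σ : Memory) : ∀ i < σ.int .n 0,
    (sketchDist.exec σ).real .ws i = rowDist (σ.real .ys) (σ.real .xs) (σ.int .s 0) i := by
  refine exec_loop_induct (N := σ.int .n 0) rfl (fun K (τ : Memory) => ∀ i < K, τ.real .ws i =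
    rowDist (σ.real .ys) (σ.real .xs) (σ.int .s 0) i) (by simp) fun K hK τ hτ hK' υ hυ hP => ?_
  have hys : τ.real .ys = σ.real .ys := hτ.real _ (by decide)
  have hxs : τ.real .xs = σ.real .xs := hτ.real _ (by decide)
  have hs : τ.int .s = σ.int .s := hτ.int _ (by decide)
  have hr : τ.real = υ.real := by rw [hυ]; rfl
  obtain ⟨ρ, hρ, hfr, h1, h2⟩ := exec_sumLoop (a := .k) (e := ivar .s) (ι := .const 0)
    (r := RName.acc) (f := .mul (.sub (.get .ys (ivar .k)) (.get .xs (idx .i .s .k)))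
      (.sub (.get .ys (ivar .k)) (.get .xs (idx .i .s .k))))
    (cs := [.setReal .ws (ivar .i) (.sqrt (rvar .acc))])
    (σ := τ) (N := σ.int .s 0) (p := 0)
    (fun k => (σ.real .ys k - σ.real .xs (K * σ.int .s 0 + k)) *
      (σ.real .ys k - σ.real .xs (K * σ.int .s 0 + k)))
    (fun ρ hρ => (by
      have : ρ.int .s = τ.int .s := hρ.int _ (by decide)
      simp [IExp.eval, ivar, this, hs]))
    (fun ρ hρ => rfl)
    (fun j hj ρ hρ hj' => by
      have h1 : ρ.int .i = τ.int .i := hρ.int _ (by decide)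
      have h2 : ρ.int .s = τ.int .s := hρ.int _ (by decide)
      have h3 : ρ.real .ys = τ.real .ys := hρ.real _ (by decide)
      have h4 : ρ.real .xs = τ.real .xs := hρ.real _ (by decide)
      simp [IExp.eval, RExp.eval, ivar, idx, h1, h2, h3, h4, hK', hj', hys, hxs, hs])
  rw [hρ]
  intro i hi
  have hi0 : ρ.int .i = τ.int .i := hfr.int _ (by decide)
  have hws : ρ.real .ws = τ.real .ws := hfr.real _ (by decide)
  by_cases hiK : i = K
  · subst hiK
    simp [block, Cmd.exec, IExp.eval, RExp.eval, ivar, rvar, hi0, hK', Mem.setReal, h1, rowDist]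
  · simp only [block, Cmd.exec, IExp.eval, RExp.eval, ivar, rvar, hi0, hK', Mem.setReal, hiK,
      and_false, if_false, hws, hr]
    exact hP i (by omega)

theorem query_exec (σ : Memory) : query.exec σ = sketchDist.exec (sketchPoint.exec σ) := rfl

theorem query_ws (σ : Memory) : ∀ i < σ.int .n 0, (query.exec σ).real .ws i =
    Real.sqrt (∑ k ∈ Finset.range (σ.int .s 0),
      (rowMul (σ.real .M) (σ.real .y) (σ.int .d 0) k 0 - σ.real .xs (i * σ.int .s 0 + k)) ^ 2) := by
  have hfr := frame_exec sketchPoint σ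
  have hn : (sketchPoint.exec σ).int .n = σ.int .n := hfr.int _ (by decide)
  have hs : (sketchPoint.exec σ).int .s = σ.int .s := hfr.int _ (by decide)
  have hxs : (sketchPoint.exec σ).real .xs = σ.real .xs := hfr.real _ (by decide)
  intro i hi
  rw [query_exec, sketchDist_exec _ i (by rwa [hn]), rowDist, hs, hxs]
  congr 1
  refine Finset.sum_congr rfl fun k hk => ?_
  rw [sketchPoint_exec σ k (Finset.mem_range.1 hk), sq]

end FastGreedy

/-! ### The values computed by sampling, sketching and searching. -/

namespace FastGreedy

open RealRAM OnlineMatching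

/-- The nested loops visit the entries in row-major order and read one bit each. Keeping `pos` equal
to the number of entries already written shows that entry `q` receives bit `q` of the tape. -/
theorem sample_exec (σ : Memory) (hpos : σ.pos = 0) :
    ∀ q < σ.int .s 0 * σ.int .d 0, (sample.exec σ).real .M q =
      boolSign (σ.tape q) / Real.sqrt (σ.int .s 0) := by
  have := exec_loop_induct (a := IName.i) (e := ivar .s) (σ := σ) (N := σ.int .s 0) rfl
    (fun k (τ : Memory) => τ.pos = k * σ.int .d 0 ∧
      ∀ q < k * σ.int .d 0, τ.real .M q = boolSign (σ.tape q) / Real.sqrt (σ.int .s 0))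
    (c := .loop .j (ivar .d) <| block
      [.flip .bit (.const 0),
       .ite (.intEq (ivar .bit) (.const 1))
         (.setReal .M (idx .i .d .j)
           (.div (.ofInt (.const 1)) (.sqrt (.ofInt (ivar .s)))))
         (.setReal .M (idx .i .d .j)
           (.sub (.ofInt (.const 0)) (.div (.ofInt (.const 1)) (.sqrt (.ofInt (ivar .s))))))])
    (by simp [hpos]) fun K hK τ hτ hK' υ hυ hP => ?_
  · exact this.2
  have hd : τ.int .d = σ.int .d := hτ.int _ (by decide)
  have hs : τ.int .s = σ.int .s := hτ.int _ (by decide)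
  have hr : τ.real = υ.real := by rw [hυ]; rfl
  have hp : τ.pos = υ.pos := by rw [hυ]; rfl
  rw [add_mul, one_mul]
  refine exec_loop_induct (N := σ.int .d 0) (by simp [IExp.eval, ivar, hd])
    (fun j (τ : Memory) => τ.pos = K * σ.int .d 0 + j ∧ ∀ q < K * σ.int .d 0 + j,
      τ.real .M q = boolSign (σ.tape q) / Real.sqrt (σ.int .s 0))
    (by simpa [hr, hp] using hP) fun j hj ρ hρ hj' π hπ hQ => ?_
  have hd' : ρ.int .d = τ.int .d := hρ.int _ (by decide)
  have hs' : ρ.int .s = τ.int .s := hρ.int _ (by decide)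
  have hi' : ρ.int .i = τ.int .i := hρ.int _ (by decide)
  have ht' : ρ.tape = σ.tape := hρ.tape.trans hτ.tape
  have hr' : ρ.real = π.real := by rw [hπ]; rfl
  have hp' : ρ.pos = π.pos := by rw [hπ]; rfl
  rw [← hr', ← hp'] at hQ
  have hM : ((block
      [.flip .bit (.const 0),
       .ite (.intEq (ivar .bit) (.const 1))
         (.setReal .M (idx .i .d .j)
           (.div (.ofInt (.const 1)) (.sqrt (.ofInt (ivar .s)))))
         (.setReal .M (idx .i .d .j)
           (.sub (.ofInt (.const 0)) (.div (.ofInt (.const 1)) (.sqrt (.ofInt (ivar .s))))))] :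
      Program).exec ρ) = ({ ρ.setInt .bit 0 (if σ.tape (K * σ.int .d 0 + j) then 1 else 0) with
        pos := ρ.pos + 1 } : Memory).setReal .M (K * σ.int .d 0 + j)
        (boolSign (σ.tape (K * σ.int .d 0 + j)) / Real.sqrt (σ.int .s 0)) := by
    cases hb : σ.tape (K * σ.int .d 0 + j) <;>
    simp [block, Cmd.exec, Cond.eval, IExp.eval, RExp.eval, ivar, idx, Mem.setInt, hQ.1, ht', hb,
      hi', hd', hs', hd, hs, hj', hK', boolSign, neg_div]
  rw [hM]
  refine ⟨by simp [Mem.setReal, hQ.1, add_assoc], fun q hq => ?_⟩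
  by_cases hqe : q = K * σ.int .d 0 + j
  · subst hqe
    simp [Mem.setReal]
  · have := hQ.2 q (by omega)
    simpa [Mem.setReal, Mem.setInt, hqe] using this

/-- Sketching one seller. -/
def sketchSeller : Program :=
  .loop .k (ivar .s) <| block <| sumLoop .j (ivar .d) (idx .i .s .k) .xs
    (.mul (.get .M (idx .k .d .j)) (.get .x (idx .i .d .j)))

/-- The second conjunct protects the rows of earlier sellers, which the outer loop invariant must
carry along. -/
theorem sketchSeller_exec (σ : Memory) :
    (∀ k < σ.int .s 0, (sketchSeller.exec σ).real .xs (σ.int .i 0 * σ.int .s 0 + k) =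
      rowMul (σ.real .M) (σ.real .x) (σ.int .d 0) k (σ.int .i 0)) ∧
    ∀ q < σ.int .i 0 * σ.int .s 0, (sketchSeller.exec σ).real .xs q = σ.real .xs q := by
  refine exec_loop_induct (N := σ.int .s 0) rfl (fun K (τ : Memory) =>
    (∀ k < K, τ.real .xs (σ.int .i 0 * σ.int .s 0 + k) =
      rowMul (σ.real .M) (σ.real .x) (σ.int .d 0) k (σ.int .i 0)) ∧
    ∀ q < σ.int .i 0 * σ.int .s 0, τ.real .xs q = σ.real .xs q)
    (by simp) fun K hK τ hτ hK' υ hυ hP => ?_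
  have hM : τ.real .M = σ.real .M := hτ.real _ (by decide)
  have hx : τ.real .x = σ.real .x := hτ.real _ (by decide)
  have hd : τ.int .d = σ.int .d := hτ.int _ (by decide)
  have hs : τ.int .s = σ.int .s := hτ.int _ (by decide)
  have hi : τ.int .i = σ.int .i := hτ.int _ (by decide)
  have hr : τ.real = υ.real := by rw [hυ]; rfl
  obtain ⟨ρ, hρ, hfr, h1, h2⟩ := exec_sumLoop (a := .j) (e := ivar .d) (ι := idx .i .s .k)
    (r := RName.xs) (f := .mul (.get .M (idx .k .d .j)) (.get .x (idx .i .d .j))) (cs := [])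
    (σ := τ) (N := σ.int .d 0) (p := σ.int .i 0 * σ.int .s 0 + K)
    (fun j => σ.real .M (K * σ.int .d 0 + j) * σ.real .x (σ.int .i 0 * σ.int .d 0 + j))
    (fun ρ hρ => (by
      have : ρ.int .d = τ.int .d := hρ.int _ (by decide)
      simp [IExp.eval, ivar, this, hd]))
    (fun ρ hρ => by
      have h1 : ρ.int .k = τ.int .k := hρ.int _ (by decide)
      have h2 : ρ.int .i = τ.int .i := hρ.int _ (by decide)
      have h3 : ρ.int .s = τ.int .s := hρ.int _ (by decide)
      simp [IExp.eval, ivar, idx, h1, h2, h3, hK', hi, hs])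
    (fun j hj ρ hρ hj' => by
      have h1 : ρ.int .k = τ.int .k := hρ.int _ (by decide)
      have h2 : ρ.int .d = τ.int .d := hρ.int _ (by decide)
      have h3 : ρ.real .M = τ.real .M := hρ.real _ (by decide)
      have h4 : ρ.real .x = τ.real .x := hρ.real _ (by decide)
      have h5 : ρ.int .i = τ.int .i := hρ.int _ (by decide)
      simp [IExp.eval, RExp.eval, ivar, idx, h1, h2, h3, h4, h5, hK', hj', hM, hx, hd, hi])
  rw [List.append_nil] at hρ
  rw [hρ, show (Cmd.exec (block []) ρ) = ρ from rfl]
  refine ⟨fun k hk => ?_, fun q hq => ?_⟩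
  · by_cases hkK : k = K
    · subst hkK
      exact h1
    · rw [h2 _ (by omega), hr]
      exact hP.1 k (by omega)
  · rw [h2 q (by omega), hr]
    exact hP.2 q hq

/-- Initializing and sketching the sellers. -/
def sketchSellers : Program :=
  .loop .i (ivar .n) <| block
    [.setReal .w (ivar .i) (.ofInt (.const 0)),
     .setInt .flag (ivar .i) (.const 1),
     .setInt .m (ivar .i) (.const 0),
     sketchSeller]

theorem sketchSellers_exec (σ : Memory) : ∀ i < σ.int .n 0,
    (sketchSellers.exec σ).real .w i = 0 ∧ (sketchSellers.exec σ).int .flag i = 1 ∧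
    (sketchSellers.exec σ).int .m i = 0 ∧
    ∀ k < σ.int .s 0, (sketchSellers.exec σ).real .xs (i * σ.int .s 0 + k) =
      rowMul (σ.real .M) (σ.real .x) (σ.int .d 0) k i := by
  refine exec_loop_induct (N := σ.int .n 0) rfl (fun K (τ : Memory) => ∀ i < K,
    τ.real .w i = 0 ∧ τ.int .flag i = 1 ∧ τ.int .m i = 0 ∧ ∀ k < σ.int .s 0,
      τ.real .xs (i * σ.int .s 0 + k) = rowMul (σ.real .M) (σ.real .x) (σ.int .d 0) k i)
    (by simp) fun K hK τ hτ hK' υ hυ hP => ?_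
  have hM : τ.real .M = σ.real .M := hτ.real _ (by decide)
  have hx : τ.real .x = σ.real .x := hτ.real _ (by decide)
  have hd : τ.int .d = σ.int .d := hτ.int _ (by decide)
  have hs : τ.int .s = σ.int .s := hτ.int _ (by decide)
  set τ' := ((τ.setReal .w K 0).setInt .flag K 1).setInt .m K 0 with hτ'
  have hfr := frame_exec sketchSeller τ'
  have hxs := sketchSeller_exec τ'
  have hP' : ∀ i < K, τ'.real .w i = 0 ∧ τ'.int .flag i = 1 ∧ τ'.int .m i = 0 ∧ ∀ k < σ.int .s 0,
      τ'.real .xs (i * σ.int .s 0 + k) = rowMul (σ.real .M) (σ.real .x) (σ.int .d 0) k i := by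
    intro i hi
    simpa [hτ', hυ, Mem.setReal, Mem.setInt, hi.ne] using hP i hi
  have h0 : τ'.real .w K = 0 ∧ τ'.int .flag K = 1 ∧ τ'.int .m K = 0 := by
    simp [hτ', Mem.setReal, Mem.setInt]
  have e1 : τ'.int .i 0 = K := by simp [hτ', Mem.setReal, Mem.setInt, hK']
  have e2 : τ'.int .s 0 = σ.int .s 0 := by simp [hτ', Mem.setReal, Mem.setInt, hs]
  have e3 : τ'.int .d 0 = σ.int .d 0 := by simp [hτ', Mem.setReal, Mem.setInt, hd]
  have e4 : τ'.real .M = σ.real .M := by ext; simp [hτ', Mem.setReal, Mem.setInt, hM]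
  have e5 : τ'.real .x = σ.real .x := by ext; simp [hτ', Mem.setReal, Mem.setInt, hx]
  rw [e1, e2, e3, e4, e5] at hxs
  have hex : ((block [.setReal .w (ivar .i) (.ofInt (.const 0)),
     .setInt .flag (ivar .i) (.const 1),
     .setInt .m (ivar .i) (.const 0),
     sketchSeller]).exec τ) = sketchSeller.exec τ' := by
    simp [block, Cmd.exec, hτ', IExp.eval, RExp.eval, ivar, Mem.setReal, Mem.setInt, hK']
  have hw : (sketchSeller.exec τ').real .w = τ'.real .w := hfr.real _ (by decide)
  have hflag : (sketchSeller.exec τ').int .flag = τ'.int .flag := hfr.int _ (by decide)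
  have hm : (sketchSeller.exec τ').int .m = τ'.int .m := hfr.int _ (by decide)
  intro i hi
  rw [hex, hw, hflag, hm]
  by_cases hiK : i = K
  · subst hiK
    exact ⟨h0.1, h0.2.1, h0.2.2, hxs.1⟩
  · have hlt : i < K := by omega
    obtain ⟨a, b, c, e⟩ := hP' i hlt
    refine ⟨a, b, c, fun k hk => ?_⟩
    rw [hxs.2 _ (mul_add_lt_mul hlt hk)]
    exact e k hk

theorem sketch_exec (σ : Memory) : ∀ i < σ.int .n 0,
    (sketch.exec σ).real .w i = 0 ∧ (sketch.exec σ).int .flag i = 1 ∧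
    (sketch.exec σ).int .m i = 0 ∧
    ∀ k < σ.int .s 0, (sketch.exec σ).real .xs (i * σ.int .s 0 + k) =
      rowMul (σ.real .M) (σ.real .x) (σ.int .d 0) k i :=
  sketchSellers_exec σ

/-- The result of the search for the best seller. -/
theorem search_exec (σ : Memory) :
    ((search.exec σ).int .found 0 = 0 ∧ ∀ i < σ.int .n 0, σ.int .flag i ≠ 1) ∨
    ((search.exec σ).int .found 0 = 1 ∧ ∃ b < σ.int .n 0, (search.exec σ).int .best 0 = b ∧
      σ.int .flag b = 1 ∧ ∀ i < σ.int .n 0, σ.int .flag i = 1 →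
        σ.real .ws i - σ.real .w i ≤ σ.real .ws b - σ.real .w b) := by
  refine exec_loop_induct (a := IName.i) (e := ivar .n) (σ := σ.setInt .found 0 0)
    (N := σ.int .n 0) (by simp [IExp.eval, ivar, Mem.setInt])
    (fun K (τ : Memory) => (τ.int .found 0 = 0 ∧ ∀ i < K, σ.int .flag i ≠ 1) ∨
      (τ.int .found 0 = 1 ∧ ∃ b < K, τ.int .best 0 = b ∧ σ.int .flag b = 1 ∧
        ∀ i < K, σ.int .flag i = 1 →
          σ.real .ws i - σ.real .w i ≤ σ.real .ws b - σ.real .w b))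
    (.inl (by simp [Mem.setInt])) fun K hK τ hτ hK' υ hυ hP => ?_
  have hτ := ((frame_setInt σ .found 0 0).mono (V' := [.found, .i, .best]) (W' := [])
    (by simp) (by simp)).trans (hτ.mono (V' := [.found, .i, .best]) (by decide) (by decide))
  have hflag : τ.int .flag = σ.int .flag := hτ.int _ (by decide)
  have hws : τ.real .ws = σ.real .ws := hτ.real _ (by decide)
  have hw : τ.real .w = σ.real .w := hτ.real _ (by decide)
  have hf : τ.int .found = υ.int .found := by
    rw [hυ]; exact Mem.int_setInt_of_ne _ _ (by decide)
  have hb : τ.int .best = υ.int .best := by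
    rw [hυ]; exact Mem.int_setInt_of_ne _ _ (by decide)
  rw [← hf, ← hb] at hP
  by_cases h1 : σ.int .flag K = 1
  · right
    rcases hP with ⟨h0, hno⟩ | ⟨h0, b, hbK, hb', hflagb, hmax⟩
    · refine ⟨?_, K, by omega, ?_, h1, fun i hi hi1 => ?_⟩
      · simp [Cmd.exec, Cond.eval, IExp.eval, ivar, block, hflag, hK', h1, h0, Mem.setInt]
      · simp [Cmd.exec, Cond.eval, IExp.eval, ivar, block, hflag, hK', h1, h0, Mem.setInt]
      · obtain rfl : i = K := by
          by_contra hne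
          exact hno i (by omega) hi1
        exact le_rfl
    · by_cases hlt : σ.real .ws b - σ.real .w b < σ.real .ws K - σ.real .w K
      · refine ⟨?_, K, by omega, ?_, h1, fun i hi hi1 => ?_⟩
        · simp [Cmd.exec, Cond.eval, IExp.eval, RExp.eval, ivar, hflag, hws, hw, hK', h1, h0, hb',
            hlt, Mem.setInt]
        · simp [Cmd.exec, Cond.eval, IExp.eval, RExp.eval, ivar, hflag, hws, hw, hK', h1, h0, hb',
            hlt, Mem.setInt]
        · by_cases hiK : i = K
          · rw [hiK]
          · exact (hmax i (by omega) hi1).trans hlt.le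
      · refine ⟨?_, b, by omega, ?_, hflagb, fun i hi hi1 => ?_⟩
        · simp [Cmd.exec, Cond.eval, IExp.eval, RExp.eval, ivar, hflag, hws, hw, hK', h1, h0, hb',
            hlt]
        · simp [Cmd.exec, Cond.eval, IExp.eval, RExp.eval, ivar, hflag, hws, hw, hK', h1, h0, hb',
            hlt]
        · by_cases hiK : i = K
          · rw [hiK]; exact not_lt.1 hlt
          · exact hmax i (by omega) hi1
  · have hex : ∀ c : Program, ((Cmd.ite (.intEq (.get .flag (ivar .i)) (.const 1)) c .skip) :
        Program).exec τ = τ := by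
      intro c
      simp [Cmd.exec, Cond.eval, IExp.eval, ivar, hflag, hK', h1]
    rw [hex]
    rcases hP with ⟨h0, hno⟩ | ⟨h0, b, hbK, hb', hflagb, hmax⟩
    · refine .inl ⟨h0, fun i hi => ?_⟩
      by_cases hiK : i = K
      · rwa [hiK]
      · exact hno i (by omega)
    · refine .inr ⟨h0, b, by omega, hb', hflagb, fun i hi hi1 => hmax i ?_ hi1⟩
      rcases Nat.lt_succ_iff_lt_or_eq.1 hi with hi | rfl
      · exact hi
      · exact absurd hi1 h1

end FastGreedy

/-! ### An update is a market step followed, for a buyer, by a greedy step. -/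

namespace FastGreedy

open RealRAM OnlineMatching

/-- Removing the sellers whose deadline has come. -/
def expire : Program :=
  .loop .i (ivar .n) <|
    .ite (.intEq (.get .dl (ivar .i)) (ivar .time))
      (.setInt .flag (ivar .i) (.const 0))
      .skip

/-- Putting an arriving seller on the market. -/
def enter : Program :=
  .loop .i (ivar .n) <|
    .ite (.intEq (ivar .who) (.add (ivar .i) (.const 1)))
      (.setInt .flag (ivar .i) (.const 1))
      .skip

/-- Matching the arriving buyer to the seller found by the search. -/
def assign : Program :=
  .ite (.intEq (ivar .found) (.const 1))
    (.ite (.realLt (.get .w (ivar .best)) (.get .ws (ivar .best)))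
      (block
        [.setInt .m (ivar .best) (ivar .time),
         .setReal .p (.const 0)
           (.sub (.add (rvar .p) (.get .ws (ivar .best))) (.get .w (ivar .best))),
         .setReal .w (ivar .best) (.get .ws (ivar .best))])
      .skip)
    .skip

theorem expire_exec (σ : Memory) : ∀ i < σ.int .n 0, (expire.exec σ).int .flag i =
    if σ.int .dl i = σ.int .time 0 then 0 else σ.int .flag i := by
  have h := exec_loop_induct (a := IName.i) (e := ivar .n) (σ := σ) (N := σ.int .n 0) rfl
    (c := .ite (.intEq (.get .dl (ivar .i)) (ivar .time))
      (.setInt .flag (ivar .i) (.const 0)) .skip)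
    (fun K (τ : Memory) => ∀ i, τ.int .flag i =
      if i < K ∧ σ.int .dl i = σ.int .time 0 then 0 else σ.int .flag i)
    (by simp) fun K hK τ hτ hK' υ hυ hP i => ?_
  · intro i hi
    have := h i
    simp only [hi, true_and] at this
    exact this
  have hdl : τ.int .dl = σ.int .dl := hτ.int _ (by decide)
  have htime : τ.int .time = σ.int .time := hτ.int _ (by decide)
  have hf : τ.int .flag = υ.int .flag := by
    rw [hυ]; exact Mem.int_setInt_of_ne _ _ (by decide)
  by_cases hc : σ.int .dl K = σ.int .time 0
  · by_cases hiK : i = K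
    · simp [Cmd.exec, Cond.eval, IExp.eval, ivar, hdl, htime, hK', hc, Mem.setInt, hiK]
    · have : i < K + 1 ↔ i < K := by omega
      simp [Cmd.exec, Cond.eval, IExp.eval, ivar, hdl, htime, hK', hc, Mem.setInt, hiK, hf, hP i,
        this]
  · by_cases hiK : i = K
    · simp [Cmd.exec, Cond.eval, IExp.eval, ivar, hdl, htime, hK', hc, hiK, hf, hP K]
    · have : i < K + 1 ↔ i < K := by omega
      simp [Cmd.exec, Cond.eval, IExp.eval, ivar, hdl, htime, hK', hc, hf, hP i, this]

theorem enter_exec (σ : Memory) : ∀ i < σ.int .n 0, (enter.exec σ).int .flag i =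
    if σ.int .who 0 = i + 1 then 1 else σ.int .flag i := by
  have h := exec_loop_induct (a := IName.i) (e := ivar .n) (σ := σ) (N := σ.int .n 0) rfl
    (c := .ite (.intEq (ivar .who) (.add (ivar .i) (.const 1)))
      (.setInt .flag (ivar .i) (.const 1)) .skip)
    (fun K (τ : Memory) => ∀ i, τ.int .flag i =
      if i < K ∧ σ.int .who 0 = i + 1 then 1 else σ.int .flag i)
    (by simp) fun K hK τ hτ hK' υ hυ hP i => ?_
  · intro i hi
    have := h i
    simp only [hi, true_and] at this
    exact this
  have hwho : τ.int .who = σ.int .who := hτ.int _ (by decide)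
  have hf : τ.int .flag = υ.int .flag := by
    rw [hυ]; exact Mem.int_setInt_of_ne _ _ (by decide)
  by_cases hc : σ.int .who 0 = K + 1
  · by_cases hiK : i = K
    · simp [Cmd.exec, Cond.eval, IExp.eval, ivar, hwho, hK', hc, Mem.setInt, hiK]
    · have : i < K + 1 ↔ i < K := by omega
      simp [Cmd.exec, Cond.eval, IExp.eval, ivar, hwho, hK', hc, Mem.setInt, hiK, hf, hP i,
        this]
  · by_cases hiK : i = K
    · simp [Cmd.exec, Cond.eval, IExp.eval, ivar, hwho, hK', hc, hiK, hf, hP K]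
    · have : i < K + 1 ↔ i < K := by omega
      simp [Cmd.exec, Cond.eval, IExp.eval, ivar, hwho, hK', hc, hf, hP i, this]

/-- One step of the greedy algorithm with edge weights `W`, where the sellers `on` are on the
market at time `t`: the matching `m`, the matching values `w` and their total `p` are updated. -/
def GreedyStep (n t : ℕ) (on : ℕ → Prop) (W : ℕ → ℝ) (m m' : ℕ → ℕ) (w w' : ℕ → ℝ) (p p' : ℝ) :
    Prop :=
  ((∀ i < n, on i → W i ≤ w i) ∧ m' = m ∧ w' = w ∧ p' = p) ∨
  ∃ b < n, on b ∧ w b < W b ∧ (∀ i < n, on i → W i - w i ≤ W b - w b) ∧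
    m' = Function.update m b t ∧ w' = Function.update w b (W b) ∧ p' = p + W b - w b

/-- If the best gain on the market is not positive, no seller on the market has a positive gain, so
leaving everything unchanged is a legitimate greedy step. -/
theorem search_assign_exec (σ : Memory) :
    GreedyStep (σ.int .n 0) (σ.int .time 0) (fun i => σ.int .flag i = 1) (σ.real .ws)
      (σ.int .m) ((assign.exec (search.exec σ)).int .m)
      (σ.real .w) ((assign.exec (search.exec σ)).real .w)
      (σ.real .p 0) ((assign.exec (search.exec σ)).real .p 0) := by
  have hfr := frame_exec search σ
  have hm : (search.exec σ).int .m = σ.int .m := hfr.int _ (by decide)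
  have ht : (search.exec σ).int .time = σ.int .time := hfr.int _ (by decide)
  have hw : (search.exec σ).real .w = σ.real .w := hfr.real _ (by decide)
  have hws : (search.exec σ).real .ws = σ.real .ws := hfr.real _ (by decide)
  have hp : (search.exec σ).real .p = σ.real .p := hfr.real _ (by decide)
  have hs := search_exec σ
  set τ := search.exec σ
  rcases hs with ⟨h0, hno⟩ | ⟨h1, b, hb, hbest, hflag, hmax⟩
  · refine .inl ⟨fun i hi hon => absurd hon (hno i hi), ?_⟩
    simp [assign, Cmd.exec, Cond.eval, IExp.eval, ivar, h0, hm, hw, hp]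
  · by_cases hlt : σ.real .w b < σ.real .ws b
    · refine .inr ⟨b, hb, hflag, hlt, hmax, ?_, ?_, ?_⟩
      · ext l
        simp [assign, block, Cmd.exec, Cond.eval, IExp.eval, RExp.eval, ivar, h1, hbest, hm, hw,
          hws, hlt, Mem.setInt, Mem.setReal, ht, Function.update_apply]
      · ext l
        simp [assign, block, Cmd.exec, Cond.eval, IExp.eval, RExp.eval, ivar, h1, hbest, hw,
          hws, hlt, Mem.setInt, Mem.setReal, Function.update_apply]
      · simp [assign, block, Cmd.exec, Cond.eval, IExp.eval, RExp.eval, ivar, rvar, h1, hbest, hw,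
          hws, hp, hlt, Mem.setInt, Mem.setReal]
    · refine .inl ⟨fun i hi hon => ?_, ?_⟩
      · have := hmax i hi hon
        linarith
      · simp [assign, Cmd.exec, Cond.eval, IExp.eval, RExp.eval, ivar, h1, hbest, hm, hw, hws, hp,
          hlt]

/-- The estimated distance between the point `y` and seller `i`. -/
noncomputable def memEstimate (σ : Memory) (i : ℕ) : ℝ :=
  Real.sqrt (∑ k ∈ Finset.range (σ.int .s 0),
      (rowMul (σ.real .M) (σ.real .y) (σ.int .d 0) k 0 - σ.real .xs (i * σ.int .s 0 + k)) ^ 2)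

/-- The first part of an update: the clock and the market. -/
def advance : Program := block
  [.setInt .time (.const 0) (.add (ivar .time) (.const 1)), expire, enter]

/-- Expiry precedes entry, so a seller arriving exactly at the deadline stays on the market; this is
the disjunction in `OnMarket`. -/
theorem advance_exec (σ : Memory) :
    (advance.exec σ).int .time 0 = σ.int .time 0 + 1 ∧
    ∀ i < σ.int .n 0, ((advance.exec σ).int .flag i = 1 ↔
      (σ.int .who 0 = i + 1 ∨ (σ.int .dl i ≠ σ.int .time 0 + 1 ∧ σ.int .flag i = 1))) := by
  set τ := σ.setInt .time 0 (σ.int .time 0 + 1) with hτ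
  have hex : advance.exec σ = enter.exec (expire.exec τ) := by
    simp [advance, block, Cmd.exec, IExp.eval, ivar, hτ]
  have h1 := frame_exec expire τ
  have h2 := frame_exec enter (expire.exec τ)
  have ht : (enter.exec (expire.exec τ)).int .time = τ.int .time :=
    (h2.int _ (by decide)).trans (h1.int _ (by decide))
  have hn : (expire.exec τ).int .n = τ.int .n := h1.int _ (by decide)
  have hwho : (expire.exec τ).int .who = τ.int .who := h1.int _ (by decide)
  rw [hex]
  refine ⟨by rw [ht]; simp [hτ, Mem.setInt], fun i hi => ?_⟩
  have hi' : i < τ.int .n 0 := by simpa [hτ, Mem.setInt] using hi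
  rw [enter_exec _ i (by rwa [hn]), expire_exec τ i hi', hwho]
  simp only [hτ, Mem.setInt]
  by_cases ha : σ.int .who 0 = i + 1 <;> by_cases hb : σ.int .dl i = σ.int .time 0 + 1 <;>
    simp [ha, hb]

theorem update_exec_seller (σ : Memory) (h : σ.int .who 0 ≠ 0) :
    update.exec σ = advance.exec σ := by
  have hfr := frame_exec advance σ
  have hwho : (advance.exec σ).int .who = σ.int .who := hfr.int _ (by decide)
  change (Cmd.ite (.intEq (ivar .who) (.const 0)) (block [query, search, assign]) .skip).exec
    (advance.exec σ) = _
  simp [Cmd.exec, Cond.eval, IExp.eval, ivar, hwho, h]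

theorem update_exec_buyer (σ : Memory) (h : σ.int .who 0 = 0) :
    update.exec σ = assign.exec (search.exec (query.exec (advance.exec σ))) := by
  have hfr := frame_exec advance σ
  have hwho : (advance.exec σ).int .who = σ.int .who := hfr.int _ (by decide)
  change (Cmd.ite (.intEq (ivar .who) (.const 0)) (block [query, search, assign]) .skip).exec
    (advance.exec σ) = _
  simp [Cmd.exec, Cond.eval, IExp.eval, ivar, hwho, h, block]

theorem update_exec_market (σ : Memory) :
    (update.exec σ).int .time 0 = σ.int .time 0 + 1 ∧
    ∀ i < σ.int .n 0, ((update.exec σ).int .flag i = 1 ↔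
      (σ.int .who 0 = i + 1 ∨ (σ.int .dl i ≠ σ.int .time 0 + 1 ∧ σ.int .flag i = 1))) := by
  by_cases h : σ.int .who 0 = 0
  · have hfr := frame_exec (block [query, search, assign]) (advance.exec σ)
    have ht : (update.exec σ).int .time = (advance.exec σ).int .time := by
      rw [update_exec_buyer σ h]; exact hfr.int _ (by decide)
    have hf : (update.exec σ).int .flag = (advance.exec σ).int .flag := by
      rw [update_exec_buyer σ h]; exact hfr.int _ (by decide)
    rw [ht, hf]
    exact advance_exec σ
  · rw [update_exec_seller σ h]
    exact advance_exec σ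

theorem GreedyStep.congr {n t : ℕ} {on on' : ℕ → Prop} {W W' : ℕ → ℝ} {m m' : ℕ → ℕ}
    {w w' : ℕ → ℝ} {p p' : ℝ} (h : GreedyStep n t on W m m' w w' p p')
    (hon : ∀ i < n, on i ↔ on' i) (hW : ∀ i < n, W i = W' i) :
    GreedyStep n t on' W' m m' w w' p p' := by
  rcases h with ⟨h, hm⟩ | ⟨b, hb, hb1, hlt, hmax, hm, hw, hp⟩
  · exact .inl ⟨fun i hi h1 => by rw [← hW i hi]; exact h i hi ((hon i hi).2 h1), hm⟩
  · rw [hW b hb] at hlt hmax hw hp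
    exact .inr ⟨b, hb, (hon b hb).1 hb1, hlt, fun i hi h1 => by
      rw [← hW i hi]; exact hmax i hi ((hon i hi).2 h1), hm, hw, hp⟩

theorem update_exec_greedy (σ : Memory) (h : σ.int .who 0 = 0) :
    GreedyStep (σ.int .n 0) (σ.int .time 0 + 1)
      (fun i => σ.int .dl i ≠ σ.int .time 0 + 1 ∧ σ.int .flag i = 1) (memEstimate σ)
      (σ.int .m) ((update.exec σ).int .m) (σ.real .w) ((update.exec σ).real .w)
      (σ.real .p 0) ((update.exec σ).real .p 0) := by
  rw [update_exec_buyer σ h]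
  have h1 := frame_exec advance σ
  have h2 := frame_exec query (advance.exec σ)
  have hst := search_assign_exec (query.exec (advance.exec σ))
  have hn : (query.exec (advance.exec σ)).int .n = σ.int .n :=
    (h2.int _ (by decide)).trans (h1.int _ (by decide))
  have hn' : (advance.exec σ).int .n = σ.int .n := h1.int _ (by decide)
  have hs' : (advance.exec σ).int .s = σ.int .s := h1.int _ (by decide)
  have hd' : (advance.exec σ).int .d = σ.int .d := h1.int _ (by decide)
  have hM' : (advance.exec σ).real .M = σ.real .M := h1.real _ (by decide)
  have hy' : (advance.exec σ).real .y = σ.real .y := h1.real _ (by decide)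
  have hxs' : (advance.exec σ).real .xs = σ.real .xs := h1.real _ (by decide)
  have hm : (query.exec (advance.exec σ)).int .m = σ.int .m :=
    (h2.int _ (by decide)).trans (h1.int _ (by decide))
  have hw : (query.exec (advance.exec σ)).real .w = σ.real .w :=
    (h2.real _ (by decide)).trans (h1.real _ (by decide))
  have hp : (query.exec (advance.exec σ)).real .p = σ.real .p :=
    (h2.real _ (by decide)).trans (h1.real _ (by decide))
  have ht : (query.exec (advance.exec σ)).int .time = (advance.exec σ).int .time :=
    h2.int _ (by decide)
  have hf : (query.exec (advance.exec σ)).int .flag = (advance.exec σ).int .flag :=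
    h2.int _ (by decide)
  rw [hn, hm, hw, hp, ht, hf, (advance_exec σ).1] at hst
  refine hst.congr (fun i hi => ?_) fun i hi => ?_
  -- At a buyer's arrival `who` is `0`, so the entry alternative `who = i + 1` disappears.
  · simpa [h] using (advance_exec σ).2 i hi
  · rw [query_ws _ i (by rwa [hn']), hs', hd', hM', hy', hxs']
    rfl

end FastGreedy

/-! ### Primal-dual analysis of the greedy algorithm. -/

namespace OnlineMatching

variable {n d : ℕ}

theorem onMarket_append (dl : Fin n → ℕ) (as bs : List (Arrival n d)) (i : Fin n) {t : ℕ}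
    (ht : t ≤ as.length) : OnMarket dl (as ++ bs) i t ↔ OnMarket dl as i t := by
  induction t with
  | zero => rfl
  | succ t ih =>
    simp only [OnMarket]
    rw [List.getElem?_append_left (by omega), ih (by omega)]

theorem isBuyer_append (as bs : List (Arrival n d)) {t : ℕ} (ht : t ≤ as.length)
    (y : EuclideanSpace ℝ (Fin d)) : IsBuyer (as ++ bs) t y ↔ IsBuyer as t y := by
  unfold IsBuyer
  refine and_congr_right fun h1 => ?_
  rw [List.getElem?_append_left (by omega)]

theorem IsBuyer.le_length {as : List (Arrival n d)} {t : ℕ} {y : EuclideanSpace ℝ (Fin d)}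
    (h : IsBuyer as t y) : t ≤ as.length := by
  have := (List.getElem?_eq_some_iff.1 h.2).1
  have := h.1
  omega

theorem isBuyer_concat_buyer {as : List (Arrival n d)} {y y' : EuclideanSpace ℝ (Fin d)} :
    IsBuyer (as ++ [.buyer y]) (as.length + 1) y' ↔ y = y' := by
  simp [IsBuyer]

theorem edgeWeight_of_isBuyer (x : Fin n → EuclideanSpace ℝ (Fin d)) {as : List (Arrival n d)}
    (i : Fin n) {t : ℕ} {y : EuclideanSpace ℝ (Fin d)} (h : IsBuyer as t y) :
    edgeWeight x as i t = ‖y - x i‖ := by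
  simp [edgeWeight, h.2]

theorem edgeWeight_nonneg (x : Fin n → EuclideanSpace ℝ (Fin d)) (as : List (Arrival n d))
    (i : Fin n) (t : ℕ) : 0 ≤ edgeWeight x as i t := by
  unfold edgeWeight
  split <;> simp

theorem weight_nonneg (x : Fin n → EuclideanSpace ℝ (Fin d)) (as : List (Arrival n d))
    (m : Fin n → Option ℕ) : 0 ≤ weight x as m := by
  refine Finset.sum_nonneg fun i _ => ?_
  split
  exacts [edgeWeight_nonneg _ _ _ _, le_rfl]

theorem opt_nonneg (x : Fin n → EuclideanSpace ℝ (Fin d)) (dl : Fin n → ℕ)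
    (as : List (Arrival n d)) : 0 ≤ opt x dl as :=
  Real.sSup_nonneg fun _ ⟨_, _, hW⟩ => hW ▸ weight_nonneg _ _ _

/-- The invariant of the greedy algorithm, where `E i y` is the weight of the edge between seller
`i` and a buyer at `y`. The numbers `g t` are the gains of the algorithm at time `t`, and form
together with `w` a solution of the dual linear program. -/
structure GreedyInv (E : Fin n → EuclideanSpace ℝ (Fin d) → ℝ) (dl : Fin n → ℕ)
    (as : List (Arrival n d)) (m : ℕ → ℕ) (w : ℕ → ℝ) (p : ℝ) : Prop where
  value : ∀ i : Fin n, (m i = 0 ∧ w i = 0) ∨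
    ∃ y, IsBuyer as (m i) y ∧ OnMarket dl as i (m i) ∧ w i = E i y
  injective : ∀ i j : Fin n, m i = m j → m i ≠ 0 → i = j
  total : p = ∑ i : Fin n, w i
  nonneg : ∀ i : Fin n, 0 ≤ w i
  dual : ∃ g : ℕ → ℝ, (∀ t, 0 ≤ g t) ∧ ∑ t ∈ Finset.Icc 1 as.length, g t = p ∧
    ∀ (i : Fin n) t y, IsBuyer as t y → OnMarket dl as i t → E i y ≤ w i + g t

variable {E : Fin n → EuclideanSpace ℝ (Fin d) → ℝ} {dl : Fin n → ℕ} {as : List (Arrival n d)}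
  {m m' : ℕ → ℕ} {w w' : ℕ → ℝ} {p p' : ℝ}

theorem greedyInv_nil (hm : ∀ i < n, m i = 0) (hw : ∀ i < n, w i = 0) :
    GreedyInv E dl [] m w 0 where
  value i := .inl ⟨hm i i.2, hw i i.2⟩
  injective i _ _ h := absurd (hm i i.2) h
  total := (Finset.sum_eq_zero fun (i : Fin n) _ => hw i i.2).symm
  nonneg i := (hw i i.2).ge
  dual := ⟨fun _ => 0, fun _ => le_rfl, by simp, fun i t y h => by
    have := h.1
    have := h.le_length
    simp only [List.length_nil] at this
    omega⟩

/-- Recorded buyers have already arrived, so the next arrival time is fresh; this preserves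
injectivity of the matching. -/
theorem GreedyInv.le_length (h : GreedyInv E dl as m w p) (i : Fin n) : m i ≤ as.length := by
  rcases h.value i with ⟨h0, _⟩ | ⟨y, hy, _⟩
  · omega
  · exact hy.le_length

/-- The invariant after an arrival at which the matching does not change. -/
theorem GreedyInv.concat_of_le (h : GreedyInv E dl as m w p) (a : Arrival n d)
    (ha : ∀ (i : Fin n) y, a = .buyer y → OnMarket dl (as ++ [a]) i (as.length + 1) →
      E i y ≤ w i) : GreedyInv E dl (as ++ [a]) m w p where
  value i := by
    refine (h.value i).imp_right fun ⟨y, hy, hon, hE⟩ =>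
      ⟨y, (isBuyer_append _ _ hy.le_length y).2 hy, (onMarket_append _ _ _ _ hy.le_length).2 hon, hE⟩
  injective := h.injective
  total := h.total
  nonneg := h.nonneg
  dual := by
    obtain ⟨g, hg, hsum, hE⟩ := h.dual
    -- No gain is made, so the new dual variable is `0`; `ha` says that `w` alone covers any new
    -- constraint.
    refine ⟨Function.update g (as.length + 1) 0, fun t => ?_, ?_, fun i t y hy hon => ?_⟩
    · by_cases ht : t = as.length + 1
      · simp [ht]
      · simp [Function.update_of_ne ht, hg t]
    · rw [List.length_append, List.length_singleton, ← Finset.insert_Icc_right_eq_Icc_add_one (by omega),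
        Finset.sum_insert (by simp), Function.update_self, zero_add, ← hsum]
      refine Finset.sum_congr rfl fun t ht => Function.update_of_ne ?_ _ _
      have := (Finset.mem_Icc.1 ht).2
      omega
    · by_cases ht : t = as.length + 1
      · subst ht
        have := ha i y (by simpa [IsBuyer] using hy.2) hon
        simpa using this
      · have hle := hy.le_length
        rw [List.length_append, List.length_singleton] at hle
        have hle : t ≤ as.length := by omega
        rw [Function.update_of_ne ht]
        exact hE i t y ((isBuyer_append _ _ hle y).1 hy) ((onMarket_append _ _ _ _ hle).1 hon)

/-- The new dual variable is the gain `W b - w b`. Maximality of `b` is precisely feasibility of the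
new constraints with the old `w`; since `w` only increases, these and all earlier constraints
survive the update. Both dual sums grow by the gain, just as `p` does. -/
theorem GreedyInv.concat_buyer (h : GreedyInv E dl as m w p) {y : EuclideanSpace ℝ (Fin d)}
    {on : ℕ → Prop} (hon : ∀ i : Fin n, on i ↔
      OnMarket dl (as ++ [.buyer y]) i (as.length + 1))
    {W : ℕ → ℝ} (hW : ∀ i : Fin n, W i = E i y)
    (hstep : FastGreedy.GreedyStep n (as.length + 1) on W m m' w w' p p') :
    GreedyInv E dl (as ++ [.buyer y]) m' w' p' := by
  rcases hstep with ⟨hle, rfl, rfl, rfl⟩ | ⟨b, hb, hbon, hlt, hmax, rfl, rfl, rfl⟩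
  · refine h.concat_of_le _ fun i y' hy' hi => ?_
    cases hy'
    rw [← hW]
    exact hle i i.2 ((hon i).2 hi)
  · have hne : ∀ i : Fin n, i ≠ ⟨b, hb⟩ → (i : ℕ) ≠ b := fun i hi h => hi (Fin.ext h)
    refine ⟨fun i => ?_, fun i j hij h0 => ?_, ?_, fun i => ?_, ?_⟩
    · by_cases hi : (i : ℕ) = b
      · right
        rw [hi, Function.update_self, Function.update_self]
        exact ⟨y, isBuyer_concat_buyer.2 rfl, (hon i).1 (hi ▸ hbon), by rw [← hi, hW]⟩
      · rw [Function.update_of_ne hi, Function.update_of_ne hi]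
        exact (h.value i).imp_right fun ⟨y, hy, hon, hE⟩ =>
          ⟨y, (isBuyer_append _ _ hy.le_length y).2 hy,
            (onMarket_append _ _ _ _ hy.le_length).2 hon, hE⟩
    · have hi' := h.le_length i
      have hj' := h.le_length j
      by_cases hi : (i : ℕ) = b <;> by_cases hj : (j : ℕ) = b
      · exact Fin.ext (hi.trans hj.symm)
      -- A shared time would force an old entry, at most `as.length`, to equal `as.length + 1`.
      · rw [hi, Function.update_self, Function.update_of_ne hj] at hij
        omega
      · rw [hj, Function.update_self, Function.update_of_ne hi] at hij
        omega
      · rw [Function.update_of_ne hi, Function.update_of_ne hj] at hij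
        rw [Function.update_of_ne hi] at h0
        exact h.injective i j hij h0
    · rw [h.total, ← Finset.add_sum_erase _ _ (Finset.mem_univ (⟨b, hb⟩ : Fin n)),
        ← Finset.add_sum_erase Finset.univ (fun i : Fin n => Function.update w b (W b) i)
          (Finset.mem_univ (⟨b, hb⟩ : Fin n))]
      have : ∑ i ∈ Finset.univ.erase (⟨b, hb⟩ : Fin n), Function.update w b (W b) i =
          ∑ i ∈ Finset.univ.erase (⟨b, hb⟩ : Fin n), w i :=
        Finset.sum_congr rfl fun i hi => Function.update_of_ne (hne i (Finset.ne_of_mem_erase hi)) _ _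
      rw [this, Function.update_self]
      ring
    · by_cases hi : (i : ℕ) = b
      · rw [hi, Function.update_self]
        exact (h.nonneg ⟨b, hb⟩).trans hlt.le
      · rw [Function.update_of_ne hi]
        exact h.nonneg i
    · obtain ⟨g, hg, hsum, hE⟩ := h.dual
      have hmono : ∀ i : Fin n, w i ≤ Function.update w b (W b) i := fun i => by
        by_cases hi : (i : ℕ) = b
        · rw [hi, Function.update_self]
          exact hlt.le
        · rw [Function.update_of_ne hi]
      refine ⟨Function.update g (as.length + 1) (W b - w b), fun t => ?_, ?_,
        fun i t y' hy hi => ?_⟩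
      · by_cases ht : t = as.length + 1
        · simp [ht, hlt.le]
        · simp [Function.update_of_ne ht, hg t]
      · rw [List.length_append, List.length_singleton,
          ← Finset.insert_Icc_right_eq_Icc_add_one (by omega),
          Finset.sum_insert (by simp), Function.update_self, add_sub_assoc, ← hsum, add_comm]
        congr 1
        refine Finset.sum_congr rfl fun t ht => Function.update_of_ne ?_ _ _
        have := (Finset.mem_Icc.1 ht).2
        omega
      · refine le_trans ?_ (add_le_add_left (hmono i) _)
        by_cases ht : t = as.length + 1
        · subst ht
          obtain rfl := isBuyer_concat_buyer.1 hy
          have := hmax i i.2 ((hon i).2 hi)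
          rw [Function.update_self, ← hW]
          linarith
        · have hle := hy.le_length
          rw [List.length_append, List.length_singleton] at hle
          have hle : t ≤ as.length := by omega
          rw [Function.update_of_ne ht]
          exact hE i t y' ((isBuyer_append _ _ hle y').1 hy) ((onMarket_append _ _ _ _ hle).1 hi)

/-- The matching given by an array of arrival times. -/
def arrayMatching (m : ℕ → ℕ) (i : Fin n) : Option ℕ := if m i = 0 then none else some (m i)

theorem GreedyInv.isMatching (h : GreedyInv E dl as m w p) :
    IsMatching dl as (arrayMatching (n := n) m) where
  feasible i t ht := by
    unfold arrayMatching at ht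
    split at ht
    · cases ht
    · rename_i h0
      obtain rfl : m i = t := by simpa using ht
      obtain ⟨y, hy, hon, -⟩ := (h.value i).resolve_left fun h => h0 h.1
      exact ⟨⟨y, hy⟩, hon⟩
  injective i j t hi hj := by
    unfold arrayMatching at hi hj
    split at hi
    · cases hi
    · rename_i h0
      split at hj
      · cases hj
      · exact h.injective i j (by simp at hi hj; omega) h0

theorem GreedyInv.weight_bounds (h : GreedyInv E dl as m w p)
    (x : Fin n → EuclideanSpace ℝ (Fin d)) {η : ℝ}
    (hE : ∀ i t y, IsBuyer as t y → (1 - η) * ‖y - x i‖ ≤ E i y ∧ E i y ≤ (1 + η) * ‖y - x i‖) :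
    (1 - η) * weight x as (arrayMatching m) ≤ p ∧
      p ≤ (1 + η) * weight x as (arrayMatching m) := by
  rw [h.total, weight, Finset.mul_sum, Finset.mul_sum]
  have key : ∀ i : Fin n, (1 - η) * (match arrayMatching m i with
        | some t => edgeWeight x as i t
        | none => 0) ≤ w i ∧ w i ≤ (1 + η) * (match arrayMatching m i with
        | some t => edgeWeight x as i t
        | none => 0) := fun i => by
    rcases h.value i with ⟨h0, hw⟩ | ⟨y, hy, hon, hw⟩
    · simp [arrayMatching, h0, hw]
    · have h0 : m i ≠ 0 := by have := hy.1; omega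
      simp only [arrayMatching, h0, if_false, edgeWeight_of_isBuyer x i hy, hw]
      exact hE i _ y hy
  exact ⟨Finset.sum_le_sum fun i _ => (key i).1, Finset.sum_le_sum fun i _ => (key i).2⟩

/-- Weak duality: each edge of `μ` is covered by `w i + g t`, the values `w i` sum to `p`, and the
gains used by `μ` sum to at most `p`. -/
theorem GreedyInv.weight_le (h : GreedyInv E dl as m w p)
    (x : Fin n → EuclideanSpace ℝ (Fin d)) {η : ℝ}
    (hE : ∀ i t y, IsBuyer as t y → (1 - η) * ‖y - x i‖ ≤ E i y)
    {μ : Fin n → Option ℕ} (hμ : IsMatching dl as μ) :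
    (1 - η) * weight x as μ ≤ 2 * p := by
  obtain ⟨g, hg, hsum, hdual⟩ := h.dual
  have h1 : (1 - η) * weight x as μ ≤ ∑ i : Fin n, (w i + (μ i).elim 0 g) := by
    rw [weight, Finset.mul_sum]
    refine Finset.sum_le_sum fun i _ => ?_
    cases hi : μ i with
    | none => simpa using h.nonneg i
    | some t =>
      obtain ⟨⟨y, hy⟩, hon⟩ := hμ.feasible i t hi
      simp only [edgeWeight_of_isBuyer x i hy, Option.elim]
      exact (hE i t y hy).trans (hdual i t y hy hon)
  have h2 : ∑ i : Fin n, (μ i).elim 0 g ≤ p := by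
    rw [← hsum]
    classical
    have e : ∑ i : Fin n, (μ i).elim 0 g =
        ∑ i ∈ Finset.univ.filter (fun i => (μ i).isSome), g ((μ i).getD 0) := by
      rw [Finset.sum_filter]
      refine Finset.sum_congr rfl fun i _ => ?_
      cases μ i <;> simp
    -- Distinct sellers use distinct buyers, so these are distinct terms of the sum over all arrival
    -- times; the omitted terms are nonnegative.
    rw [e, ← Finset.sum_image (g := fun i => (μ i).getD 0) (f := g)]
    · refine Finset.sum_le_sum_of_subset_of_nonneg (fun t ht => ?_) fun t _ _ => hg t
      obtain ⟨i, hi, rfl⟩ := Finset.mem_image.1 ht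
      obtain ⟨t, ht⟩ := Option.isSome_iff_exists.1 (Finset.mem_filter.1 hi).2
      obtain ⟨⟨y, hy⟩, -⟩ := hμ.feasible i t ht
      rw [ht]
      exact Finset.mem_Icc.2 ⟨hy.1, hy.le_length⟩
    · intro i hi j hj hij
      obtain ⟨t, ht⟩ := Option.isSome_iff_exists.1 (Finset.mem_filter.1 hi).2
      obtain ⟨t', ht'⟩ := Option.isSome_iff_exists.1 (Finset.mem_filter.1 hj).2
      simp only [ht, ht', Option.getD_some] at hij
      subst hij
      exact hμ.injective i j t ht ht'
  rw [Finset.sum_add_distrib, ← h.total] at h1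
  linarith

/-- Distortion `ε / 2` suffices for the factor `1 - ε` even after two losses: comparing `opt` with
`p`, then `p` with the true weight of the matching. -/
theorem GreedyInv.competitive (h : GreedyInv E dl as m w p)
    (x : Fin n → EuclideanSpace ℝ (Fin d)) {ε : ℝ} (h0 : 0 < ε) (h1 : ε < 1)
    (hE : ∀ i t y, IsBuyer as t y →
      (1 - ε / 2) * ‖y - x i‖ ≤ E i y ∧ E i y ≤ (1 + ε / 2) * ‖y - x i‖) :
    (1 - ε) * weight x as (arrayMatching m) ≤ p ∧
    p ≤ (1 + ε) * weight x as (arrayMatching m) ∧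
    (1 - ε) / 2 * opt x dl as ≤ p ∧
    (1 - ε) / 2 * opt x dl as ≤ weight x as (arrayMatching m) := by
  obtain ⟨ha, hb⟩ := h.weight_bounds x hE
  have hw := weight_nonneg x as (arrayMatching m)
  have hopt := opt_nonneg x dl as
  have hp : 0 ≤ p := by
    rw [h.total]
    exact Finset.sum_nonneg fun i _ => h.nonneg i
  have hopt' : (1 - ε / 2) * opt x dl as ≤ 2 * p := by
    rw [mul_comm, ← le_div_iff₀ (by linarith)]
    refine Real.sSup_le ?_ (div_nonneg (by linarith) (by linarith))
    rintro _ ⟨μ, hμ, rfl⟩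
    rw [le_div_iff₀ (by linarith), mul_comm]
    exact h.weight_le x (fun i t y hy => (hE i t y hy).1) hμ
  refine ⟨by nlinarith, by nlinarith, by nlinarith, ?_⟩
  -- The two losses combine through `(1 - ε) (1 + ε / 2) ≤ 1 - ε / 2`.
  have h3 : (1 - ε) * (1 + ε / 2) * opt x dl as ≤
      2 * ((1 + ε / 2) * weight x as (arrayMatching m)) := by
    refine le_trans (mul_le_mul_of_nonneg_right ?_ hopt) (hopt'.trans (by linarith))
    nlinarith
  have h4 : 0 < 1 + ε / 2 := by linarith
  refine le_of_mul_le_mul_left ?_ h4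
  linarith

end OnlineMatching

/-! ### The invariant of the memory along a sequence of calls. -/

namespace FastGreedy

open RealRAM OnlineMatching

variable {n d : ℕ}

/-- The members of the data structure that do not change after the initialization. -/
structure Static (ω : ℕ → Bool) (s : ℕ) (x : Fin n → EuclideanSpace ℝ (Fin d)) (dl : Fin n → ℕ)
    (σ : Memory) : Prop where
  n_eq : σ.int .n 0 = n
  d_eq : σ.int .d 0 = d
  s_eq : σ.int .s 0 = s
  dl_eq : ∀ i : Fin n, σ.int .dl i = dl i
  x_eq : ∀ (i : Fin n) (j : Fin d), σ.real .x (i * d + j) = x i j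
  M_eq : ∀ q < s * d, σ.real .M q = boolSign (ω q) / Real.sqrt s
  xs_eq : ∀ i : Fin n, ∀ k < s, σ.real .xs (i * s + k) = rowMul (σ.real .M) (σ.real .x) d k i

variable {ω : ℕ → Bool} {s : ℕ} {x : Fin n → EuclideanSpace ℝ (Fin d)} {dl : Fin n → ℕ}
  {σ τ : Memory}

theorem Static.of_frame {V : List IName} {W : List RName} (h : Static ω s x dl σ)
    (hf : Frame V W σ τ) (hV : .n ∉ V ∧ .d ∉ V ∧ .s ∉ V ∧ .dl ∉ V)
    (hW : .x ∉ W ∧ .M ∉ W ∧ .xs ∉ W) : Static ω s x dl τ := by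
  obtain ⟨h1, h2, h3, h4⟩ := hV
  obtain ⟨h5, h6, h7⟩ := hW
  obtain ⟨a, b, c, e, f, g, k⟩ := h
  constructor
  · rwa [hf.int _ h1]
  · rwa [hf.int _ h2]
  · rwa [hf.int _ h3]
  · rwa [hf.int _ h4]
  · rwa [hf.real _ h5]
  · rwa [hf.real _ h6]
  · rwa [hf.real _ h7, hf.real _ h6, hf.real _ h5]

/-- Linearity of the sketch: the difference of the sketches of `y` and `x i` is the sketch of `y - x
i`, a vector independent of the random bits. -/
theorem Static.memEstimate (h : Static ω s x dl σ) {y : EuclideanSpace ℝ (Fin d)}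
    (hy : ∀ j : Fin d, σ.real .y j = y j) (i : Fin n) :
    memEstimate σ i = sketchNorm ω s (y - x i).ofLp := by
  rw [FastGreedy.memEstimate, sketchNorm, h.s_eq, h.d_eq, Finset.sum_range]
  congr 1
  refine Finset.sum_congr rfl fun k _ => ?_
  rw [h.xs_eq i k k.2, rowMul, rowMul, ← Finset.sum_sub_distrib, Finset.sum_range]
  congr 1
  refine Finset.sum_congr rfl fun j _ => ?_
  rw [h.M_eq _ (mul_add_lt_mul k.2 j.2), zero_mul, zero_add, hy, h.x_eq]
  simp only [PiLp.sub_apply]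
  ring

theorem load_y (σ : Memory) (y : EuclideanSpace ℝ (Fin d)) (j : Fin d) :
    (σ.loadReal .y fun j => y j).real .y j = y j := by
  simp [Mem.loadReal]

theorem frame_loadReal (σ : Memory) {m : ℕ} (a : RName) (v : Fin m → ℝ) :
    Frame [] [a] σ (σ.loadReal a v) :=
  ⟨fun _ _ => rfl, fun b hb => by ext l; simp_all [Mem.loadReal], rfl⟩

theorem frame_load (c : Call n d) (σ : Memory) : Frame [.who] [.y] σ (c.load σ) := by
  match c with
  | .update (.seller i) => exact (frame_setInt σ _ _ _).mono (by simp) (by simp)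
  | .update (.buyer y) =>
    exact ((frame_setInt σ _ _ _).mono (by simp) (by simp)).trans
      ((frame_loadReal _ _ _).mono (by simp) (by simp))
  | .query y => exact (frame_loadReal _ _ _).mono (by simp) (by simp)
  | .totalWeight => exact .refl _ _ _

theorem Static.load (h : Static ω s x dl σ) (c : Call n d) : Static ω s x dl (c.load σ) :=
  h.of_frame (frame_load c σ) (by decide) (by decide)

theorem Static.run (h : Static ω s x dl σ) (c : Call n d) : Static ω s x dl (c.run σ) := by
  cases c with
  | update a => exact (h.load _).of_frame (frame_exec FastGreedy.update _) (by decide) (by decide)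
  | query y => exact (h.load _).of_frame (frame_exec FastGreedy.query _) (by decide) (by decide)
  | totalWeight =>
    exact (h.load _).of_frame (frame_exec FastGreedy.totalWeight _) (by decide) (by decide)

theorem Static.estimate (h : Static ω s x dl σ) (y : EuclideanSpace ℝ (Fin d)) (i : Fin n) :
    estimate σ y i = sketchNorm ω s (y - x i).ofLp := by
  have hl := h.load (.query y)
  rw [← hl.memEstimate (load_y σ y) i]
  exact query_ws _ i (by rw [hl.n_eq]; exact i.2)

theorem sampleInput_x (C : ℕ) (ε δ : ℝ) (i : Fin n) (j : Fin d) :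
    (sampleInput C ε δ x dl ω).real .x (i * d + j) = x i j := by
  have h : (i * d + j : ℕ) < n * d := mul_add_lt_mul i.2 j.2
  have hd : 0 < d := j.pos
  have h1 : (⟨i * d + j, h⟩ : Fin (n * d)).divNat = i :=
    Fin.ext (by simp [Fin.divNat, mul_comm _ d, Nat.mul_add_div hd, Nat.div_eq_of_lt j.2])
  have h2 : (⟨i * d + j, h⟩ : Fin (n * d)).modNat = j :=
    Fin.ext (by simp [Fin.modNat, Nat.mod_eq_of_lt j.2])
  simp [sampleInput, initInput, Mem.setInt, Mem.setReal, Mem.loadInt, Mem.loadReal, h, h1, h2]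

/-- The invariant of the data structure. -/
structure DataInv (ω : ℕ → Bool) (s : ℕ) (x : Fin n → EuclideanSpace ℝ (Fin d)) (dl : Fin n → ℕ)
    (as : List (Arrival n d)) (σ : Memory) : Prop where
  static : Static ω s x dl σ
  time : σ.int .time 0 = as.length
  flag : ∀ i : Fin n, σ.int .flag i = 1 ↔ OnMarket dl as i as.length
  greedy : GreedyInv (fun i y => sketchNorm ω s (y - x i).ofLp) dl as (σ.int .m) (σ.real .w)
    (σ.real .p 0)

theorem inv_init (C : ℕ) (ε δ : ℝ) (x : Fin n → EuclideanSpace ℝ (Fin d)) (dl : Fin n → ℕ)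
    (ω : ℕ → Bool) (hn : 0 < n) :
    DataInv ω (rows C ε δ n) x dl [] ((init C).exec (initInput ε δ x dl ω)) := by
  rw [init_exec]
  set σ := sampleInput C ε δ x dl ω with hσ
  set s := rows C ε δ n with hs
  have hT := typed_sampleInput C ε δ x dl ω hn
  have e1 : σ.int .n 0 = n := hT.scalar .n
  have e2 : σ.int .d 0 = d := hT.scalar .d
  have e3 : σ.int .s 0 = s := hT.scalar .s
  have htape : σ.tape = ω := rfl
  have hpos : σ.pos = 0 := rfl
  have hp0 : σ.real .p 0 = 0 := by simp [hσ, sampleInput, Mem.setInt, Mem.setReal]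
  have ht0 : σ.int .time 0 = 0 := by simp [hσ, sampleInput, Mem.setInt]
  have hdl : ∀ i : Fin n, σ.int .dl i = dl i := fun i => by
    simp [hσ, sampleInput, initInput, Mem.setInt, Mem.setReal, Mem.loadInt]
  have hM := sample_exec σ hpos
  rw [e2, e3, htape] at hM
  have f1 := frame_exec sample σ
  have f2 := frame_exec sketch (sample.exec σ)
  have f := (f1.mono (V' := sample.intVars ++ sketch.intVars)
    (W' := sample.realVars ++ sketch.realVars) (by simp) (by simp)).trans
    (f2.mono (by simp) (by simp))
  have n1 : (sample.exec σ).int .n 0 = n := by rwa [f1.int _ (by decide)]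
  have d1 : (sample.exec σ).int .d 0 = d := by rwa [f1.int _ (by decide)]
  have s1 : (sample.exec σ).int .s 0 = s := by rwa [f1.int _ (by decide)]
  have hsk := sketch_exec (sample.exec σ)
  rw [n1, d1, s1] at hsk
  refine ⟨⟨?_, ?_, ?_, ?_, ?_, ?_, ?_⟩, ?_, fun i => ?_, ?_⟩
  · rwa [f.int _ (by decide)]
  · rwa [f.int _ (by decide)]
  · rwa [f.int _ (by decide)]
  · rwa [f.int _ (by decide)]
  · rw [f.real _ (by decide)]
    exact sampleInput_x C ε δ
  · rwa [f2.real .M (by decide)]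
  · rw [f2.real .M (by decide), f2.real .x (by decide)]
    exact fun i => (hsk i i.2).2.2.2
  · rwa [f.int _ (by decide)]
  · exact iff_of_true (hsk i i.2).2.1 trivial
  · rw [f.real .p (by decide), hp0]
    exact greedyInv_nil (fun i hi => (hsk i hi).2.2.1) fun i hi => (hsk i hi).1

theorem DataInv.update_seller {as : List (Arrival n d)} (h : DataInv ω s x dl as σ) (j : Fin n) :
    DataInv ω s x dl (as ++ [.seller j]) ((Call.update (.seller j) : Call n d).run σ) := by
  have hst := h.static.run (.update (.seller j))
  set τ := (Call.update (.seller j) : Call n d).load σ with hτ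
  have hfr : Frame [.who] [.y] σ τ := frame_load _ σ
  have hwho : τ.int .who 0 = j + 1 := by simp [hτ, Call.load, Mem.setInt]
  have hl : Static ω s x dl τ := h.static.load _
  have ht : τ.int .time = σ.int .time := hfr.int _ (by decide)
  have hf : τ.int .flag = σ.int .flag := hfr.int _ (by decide)
  have hm : τ.int .m = σ.int .m := hfr.int _ (by decide)
  have hw : τ.real .w = σ.real .w := hfr.real _ (by decide)
  have hp : τ.real .p = σ.real .p := hfr.real _ (by decide)
  have hmk := update_exec_market τ
  rw [ht, h.time, hl.n_eq, hf, hwho] at hmk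
  change DataInv ω s x dl (as ++ [.seller j]) (FastGreedy.update.exec τ)
  have hadv := frame_exec advance τ
  have hupd := update_exec_seller τ (by omega)
  refine ⟨hst, ?_, fun i => ?_, ?_⟩
  · simpa using hmk.1
  · rw [hmk.2 i i.2, List.length_append, List.length_singleton, OnMarket, hl.dl_eq, h.flag,
      onMarket_append _ _ _ _ le_rfl]
    refine or_congr ?_ Iff.rfl
    simp [Fin.ext_iff]
  · rw [hupd, hadv.int .m (by decide), hadv.real .w (by decide), hadv.real .p (by decide), hm, hw,
      hp]
    -- A seller's arrival creates no dual constraint.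
    exact h.greedy.concat_of_le _ fun i y hy => by cases hy

theorem DataInv.update_buyer {as : List (Arrival n d)} (h : DataInv ω s x dl as σ)
    (y : EuclideanSpace ℝ (Fin d)) :
    DataInv ω s x dl (as ++ [.buyer y]) ((Call.update (.buyer y) : Call n d).run σ) := by
  have hst := h.static.run (.update (.buyer y))
  set τ := (Call.update (.buyer y) : Call n d).load σ with hτ
  have hfr : Frame [.who] [.y] σ τ := frame_load _ σ
  have hwho : τ.int .who 0 = 0 := by simp [hτ, Call.load, Mem.setInt, Mem.loadReal]
  have hl : Static ω s x dl τ := h.static.load _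
  have ht : τ.int .time = σ.int .time := hfr.int _ (by decide)
  have hf : τ.int .flag = σ.int .flag := hfr.int _ (by decide)
  have hm : τ.int .m = σ.int .m := hfr.int _ (by decide)
  have hw : τ.real .w = σ.real .w := hfr.real _ (by decide)
  have hp : τ.real .p = σ.real .p := hfr.real _ (by decide)
  have hmk := update_exec_market τ
  have hgr := update_exec_greedy τ hwho
  rw [ht, h.time, hl.n_eq, hf, hwho] at hmk
  rw [ht, h.time, hl.n_eq, hf, hm, hw, hp] at hgr
  change DataInv ω s x dl (as ++ [.buyer y]) (FastGreedy.update.exec τ)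
  have hon : ∀ i : Fin n, (τ.int .dl i ≠ as.length + 1 ∧ σ.int .flag i = 1) ↔
      OnMarket dl (as ++ [.buyer y]) i (as.length + 1) := fun i => by
    rw [OnMarket, hl.dl_eq, h.flag, onMarket_append _ _ _ _ le_rfl]
    simp
  refine ⟨hst, ?_, fun i => ?_, ?_⟩
  · simpa using hmk.1
  · rw [hmk.2 i i.2, List.length_append, List.length_singleton, ← hon i]
    simp
  · exact h.greedy.concat_buyer hon (fun i => hl.memEstimate (load_y _ y) i) hgr

theorem DataInv.of_frame {as : List (Arrival n d)} (h : DataInv ω s x dl as σ) (c : Call n d)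
    {V : List IName} {W : List RName} (hf : Frame V W σ (c.run σ))
    (hV : .time ∉ V ∧ .flag ∉ V ∧ .m ∉ V) (hW : .w ∉ W ∧ .p ∉ W) :
    DataInv ω s x dl as (c.run σ) := by
  refine ⟨h.static.run c, ?_, ?_, ?_⟩
  · rw [hf.int _ hV.1]; exact h.time
  · rw [hf.int _ hV.2.1]; exact h.flag
  · rw [hf.int _ hV.2.2, hf.real _ hW.1, hf.real _ hW.2]; exact h.greedy

theorem arrivals_append (cs cs' : List (Call n d)) :
    arrivals (cs ++ cs') = arrivals cs ++ arrivals cs' := by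
  induction cs with
  | nil => rfl
  | cons c cs ih => cases c <;> simp [arrivals, ih]

/-- This holds for every tape: the program is an exact greedy algorithm for the sketched distances,
however inaccurate they may be. -/
theorem inv_state (C : ℕ) (ε δ : ℝ) (x : Fin n → EuclideanSpace ℝ (Fin d)) (dl : Fin n → ℕ)
    (calls : List (Call n d)) (ω : ℕ → Bool) (hn : 0 < n) :
    DataInv ω (rows C ε δ n) x dl (arrivals calls) (state C ε δ x dl calls ω) := by
  induction calls using List.reverseRecOn with
  | nil => exact inv_init C ε δ x dl ω hn
  | append_singleton calls c ih =>
    rw [state_concat, arrivals_append]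
    match c with
    | .update (.seller j) => exact ih.update_seller j
    | .update (.buyer y) => exact ih.update_buyer y
    | .query y =>
      rw [show arrivals [(.query y : Call n d)] = [] from rfl, List.append_nil]
      exact ih.of_frame _ (V := .who :: FastGreedy.query.intVars)
        (W := .y :: FastGreedy.query.realVars)
        (((frame_load _ _).mono (by simp) (by simp)).trans
          ((frame_exec FastGreedy.query _).mono (by simp) (by simp))) (by decide) (by decide)
    | .totalWeight =>
      rw [show arrivals [(.totalWeight : Call n d)] = [] from rfl, List.append_nil]
      exact ih.of_frame _ (V := FastGreedy.totalWeight.intVars)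
        (W := FastGreedy.totalWeight.realVars)
        (frame_exec FastGreedy.totalWeight _) (by decide) (by decide)

theorem totalWeightValue_eq (σ : Memory) : totalWeightValue n d σ = σ.real .p 0 := by
  simp [totalWeightValue, Call.run, Call.program, Call.load, totalWeight, Cmd.exec, Mem.setReal,
    RExp.eval, rvar, IExp.eval]

/-! ### The union bound over sellers and query points. -/

/-- The buyers among the arrivals. -/
def buyers : List (Arrival n d) → List (EuclideanSpace ℝ (Fin d))
  | [] => []
  | .seller _ :: as => buyers as
  | .buyer y :: as => y :: buyers as

theorem length_buyers (as : List (Arrival n d)) : (buyers as).length = numBuyers as := by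
  induction as with
  | nil => rfl
  | cons a as ih => cases a <;> simp [buyers, numBuyers, ih]

theorem mem_buyers {as : List (Arrival n d)} {y : EuclideanSpace ℝ (Fin d)}
    (h : .buyer y ∈ as) : y ∈ buyers as := by
  induction as with
  | nil => cases h
  | cons a as ih =>
    rcases List.mem_cons.1 h with rfl | h'
    · simp [buyers]
    · cases a
      · exact ih h'
      · exact List.mem_cons_of_mem _ (ih h')

/-- With high probability, the sketch has small distortion on all given pairs. -/
theorem sketch_accurate {ε δ η : ℝ} (hε : 0 < ε) (hε1 : ε < 1) (hδ : 0 < δ) (hδ1 : δ < 1)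
    (hn : 2 * δ ≤ n) (hη : ε / 2 ≤ η) (hη1 : η ≤ 1) (x : Fin n → EuclideanSpace ℝ (Fin d))
    (ys : List (EuclideanSpace ℝ (Fin d))) (hys : ys.length ≤ n) :
    ENNReal.ofReal (1 - δ) ≤ fairCoins {ω | ∀ y ∈ ys, ∀ i,
      (1 - η) * ‖y - x i‖ ≤ sketchNorm ω (rows 144 ε δ n) (y - x i).ofLp ∧
        sketchNorm ω (rows 144 ε δ n) (y - x i).ofLp ≤ (1 + η) * ‖y - x i‖} := by
  obtain ⟨hL, -, hs, hspos⟩ := rows_bounds (C := 144) (by norm_num) hε hε1 hδ hn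
  set s := rows 144 ε δ n
  have hn0 : (0 : ℝ) < n := by linarith
  have hexp : Real.exp (-(s * η ^ 2 / 12)) ≤ (δ / n) ^ 3 := by
    -- The choice of `144`: since `s ε² ≥ 144 log (n / δ)` and `η ≥ ε / 2`, the exponent is at least
    -- `144 / (4 · 12) = 3` times the logarithm.
    have h1 : 3 * Real.log (n / δ) ≤ s * η ^ 2 / 12 := by
      have h2 : 3 * Real.log (n / δ) ≤ s * (ε / 2) ^ 2 / 12 := by
        have := mul_le_mul_of_nonneg_right hs (sq_nonneg ε)
        have e : ((144 : ℕ) : ℝ) * ((ε ^ 2)⁻¹ * Real.log (n / δ)) * ε ^ 2 =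
            144 * Real.log (n / δ) := by
          push_cast
          field_simp
        rw [e] at this
        linarith
      refine h2.trans ?_
      gcongr
    calc Real.exp (-(s * η ^ 2 / 12)) ≤ Real.exp (-(3 * Real.log (n / δ))) :=
          Real.exp_le_exp.2 (neg_le_neg h1)
      _ = (δ / n) ^ 3 := by
          rw [show -(3 * Real.log (n / δ)) = ((3 : ℕ) : ℝ) * Real.log (δ / n) by
            rw [← inv_div, Real.log_inv]; push_cast; ring, Real.exp_nat_mul,
            Real.exp_log (by positivity)]
  set G : Set (ℕ → Bool) := {ω | ∀ y ∈ ys, ∀ i,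
      (1 - η) * ‖y - x i‖ ≤ sketchNorm ω s (y - x i).ofLp ∧
        sketchNorm ω s (y - x i).ofLp ≤ (1 + η) * ‖y - x i‖}
  have hbad : fairCoins.real Gᶜ ≤ δ := by
    have hsub : Gᶜ ⊆ ⋃ q : Fin ys.length × Fin n, {ω | ¬ ((1 - η) * ‖ys.get q.1 - x q.2‖ ≤
        sketchNorm ω s (ys.get q.1 - x q.2).ofLp ∧
        sketchNorm ω s (ys.get q.1 - x q.2).ofLp ≤ (1 + η) * ‖ys.get q.1 - x q.2‖)} := by
      intro ω hω
      simp only [G, Set.mem_compl_iff, Set.mem_ofPred_eq, not_forall] at hω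
      obtain ⟨y, hy, i, hi⟩ := hω
      obtain ⟨k, rfl⟩ := List.get_of_mem hy
      exact Set.mem_iUnion.2 ⟨(k, i), hi⟩
    refine (measureReal_mono hsub).trans ((measureReal_iUnion_fintype_le _).trans ?_)
    calc _ ≤ ∑ q : Fin ys.length × Fin n, 2 * (δ / n) ^ 3 := by
          refine Finset.sum_le_sum fun q _ => ?_
          refine (sketchNorm_distortion hspos _ (by linarith) hη1).trans ?_
          gcongr
      _ = ys.length * n * (2 * (δ / n) ^ 3) := by simp
      -- At most `n²` pairs. The cube leaves `2 δ³ / n`, which `2 δ ≤ n` brings down to `δ²`, so the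
      -- factor `2` costs nothing.
      _ ≤ n * n * (2 * (δ / n) ^ 3) := by gcongr
      _ = 2 * δ / n * δ ^ 2 := by field_simp
      _ ≤ 1 * δ ^ 2 := by
          gcongr
          rwa [div_le_one hn0]
      _ ≤ δ := by nlinarith
  have h1 : 1 ≤ fairCoins.real G + fairCoins.real Gᶜ := by
    have := measureReal_union_le (μ := fairCoins) G Gᶜ
    rwa [Set.union_compl_self, probReal_univ] at this
  rw [ENNReal.ofReal_le_iff_le_toReal (measure_ne_top _ _)]
  change 1 - δ ≤ fairCoins.real G
  linarith

end FastGreedy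

/-! ### Final arithmetic and assembly of the theorem. -/

namespace FastGreedy

open RealRAM OnlineMatching

variable {n d : ℕ}

/-- Real bounds for the parameters of the running times. -/
theorem cost_bounds {s : ℕ} {L : ℝ} (hn : 1 ≤ n) (hd : 1 ≤ d) (hL : 1 / 2 ≤ L)
    (hs : (s : ℝ) ≤ 146 * L) :
    (s : ℝ) * d + n * s + s + n + 1 ≤ 300 * (L * (n + d)) := by
  have hn' : (1 : ℝ) ≤ n := by exact_mod_cast hn
  have hd' : (1 : ℝ) ≤ d := by exact_mod_cast hd
  have h1 : (s : ℝ) * (d + n + 1) ≤ 146 * L * (d + n + 1) := by gcongr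
  have h2 : L * 1 ≤ L * n := by gcongr
  have h3 : 1 / 2 * (n + d : ℝ) ≤ L * (n + d) := by gcongr
  have h4 : 0 ≤ L * d := by positivity
  nlinarith

/-- Every term is at most `n * d * s` up to its coefficient, because all three factors are at least
`1`. -/
theorem init_bounds {s : ℕ} {L : ℝ} (hn : 1 ≤ n) (hd : 1 ≤ d) (hL : 1 / 2 ≤ L) (hs1 : 1 ≤ s)
    (hs : (s : ℝ) ≤ 146 * L) :
    25 + s + 100 * ((s : ℝ) * d + s + 1) + 100 * (n * s * d + n * s + n + 1) ≤
      1000000 * (L * (n * d)) := by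
  have h : 25 + s + 100 * (s * d + s + 1) + 100 * (n * s * d + n * s + n + 1) ≤
      826 * (n * d * s) := by
    have h1 : 1 ≤ n * d := Nat.mul_pos hn hd
    have h2 : s ≤ n * d * s := Nat.le_mul_of_pos_left s h1
    have h3 : s * d ≤ n * d * s := by
      calc s * d = 1 * d * s := by ring
        _ ≤ n * d * s := by gcongr
    have h4 : n * s ≤ n * d * s := by
      calc n * s = n * 1 * s := by ring
        _ ≤ n * d * s := by gcongr
    have h5 : n ≤ n * s := Nat.le_mul_of_pos_right n hs1
    have h6 : n * s * d = n * d * s := by ring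
    omega
  have h' : (25 : ℝ) + s + 100 * ((s : ℝ) * d + s + 1) + 100 * (n * s * d + n * s + n + 1) ≤
      826 * (n * d * s) := by exact_mod_cast h
  refine h'.trans ?_
  have h1 : (n * d : ℝ) * s ≤ n * d * (146 * L) := by gcongr
  have h2 : 0 ≤ L * (n * d) := by positivity
  linarith

end FastGreedy

theorem mainTheorem3 :
    ∃ (C : ℕ) (K : ℝ), 0 < C ∧ 0 < K ∧
      ∀ (n d : ℕ) (ε δ : ℝ) (x : Fin n → EuclideanSpace ℝ (Fin d)) (dl : Fin n → ℕ),
        1 ≤ d → 0 < ε → ε < 1 → 0 < δ → δ < 1 → 2 * δ ≤ (n : ℝ) →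
        -- time of the initialization
        (∀ ω : ℕ → Bool, (FastGreedy.initTime C ε δ x dl ω : ℝ) ≤
          K * ((ε ^ 2)⁻¹ * (n * d) * Real.log (n / δ))) ∧
        -- space, after any sequence of calls
        (∀ (calls : List (FastGreedy.Call n d)) (ω : ℕ → Bool),
          ((FastGreedy.state C ε δ x dl calls ω).space : ℝ) ≤
            K * (n * d + (ε ^ 2)⁻¹ * (n + d) * Real.log (n / δ))) ∧
        -- time of the operations, after any sequence of calls
        (∀ (calls : List (FastGreedy.Call n d)) (ω : ℕ → Bool),
          (∀ a : OnlineMatching.Arrival n d,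
            ((FastGreedy.Call.update a).time (FastGreedy.state C ε δ x dl calls ω) : ℝ) ≤
              K * ((ε ^ 2)⁻¹ * (n + d) * Real.log (n / δ))) ∧
          (∀ y : EuclideanSpace ℝ (Fin d),
            ((FastGreedy.Call.query y : FastGreedy.Call n d).time
                (FastGreedy.state C ε δ x dl calls ω) : ℝ) ≤
              K * ((ε ^ 2)⁻¹ * (n + d) * Real.log (n / δ))) ∧
          ((FastGreedy.Call.totalWeight : FastGreedy.Call n d).time
              (FastGreedy.state C ε δ x dl calls ω) : ℝ) ≤ K) ∧
        -- accuracy of a query, after any sequence of calls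
        (∀ (calls : List (FastGreedy.Call n d)) (y : EuclideanSpace ℝ (Fin d)),
          ENNReal.ofReal (1 - δ) ≤ FastGreedy.fairCoins {ω | ∀ i : Fin n,
            (1 - ε) * ‖y - x i‖ ≤
              FastGreedy.estimate (FastGreedy.state C ε δ x dl calls ω) y i ∧
            FastGreedy.estimate (FastGreedy.state C ε δ x dl calls ω) y i ≤
              (1 + ε) * ‖y - x i‖}) ∧
        -- competitiveness, after any sequence of calls with at most `n` buyers
        (∀ calls : List (FastGreedy.Call n d),
          OnlineMatching.numBuyers (FastGreedy.arrivals calls) ≤ n →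
          ENNReal.ofReal (1 - δ) ≤ FastGreedy.fairCoins {ω |
            let p := FastGreedy.totalWeightValue n d (FastGreedy.state C ε δ x dl calls ω)
            let m := FastGreedy.matching n (FastGreedy.state C ε δ x dl calls ω)
            let as := FastGreedy.arrivals calls
            OnlineMatching.IsMatching dl as m ∧
            (1 - ε) * OnlineMatching.weight x as m ≤ p ∧
            p ≤ (1 + ε) * OnlineMatching.weight x as m ∧
            (1 - ε) / 2 * OnlineMatching.opt x dl as ≤ p ∧
            (1 - ε) / 2 * OnlineMatching.opt x dl as ≤ OnlineMatching.weight x as m}) := by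
  refine ⟨144, 1000000, by norm_num, by norm_num,
    fun n d ε δ x dl hd hε hε1 hδ hδ1 hn => ?_⟩
  have hn1 : 1 ≤ n := by
    rw [Nat.one_le_iff_ne_zero]
    rintro rfl
    rw [Nat.cast_zero] at hn
    linarith
  obtain ⟨hL, hs, -, hs1⟩ := FastGreedy.rows_bounds (C := 144) (by norm_num) hε hε1 hδ hn
  -- Rounding up adds at most `1`, absorbed by `2 L` since `L ≥ 1/2`; hence `146` instead of `144`.
  have hs : (FastGreedy.rows 144 ε δ n : ℝ) ≤ 146 * ((ε ^ 2)⁻¹ * Real.log (n / δ)) := by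
    refine hs.trans_eq ?_
    norm_num
  have hcost := FastGreedy.cost_bounds hn1 hd hL hs
  have hmul : ∀ a : ℝ, (ε ^ 2)⁻¹ * a * Real.log (n / δ) = (ε ^ 2)⁻¹ * Real.log (n / δ) * a :=
    fun a => by ring
  simp only [hmul]
  have hT := fun calls ω => FastGreedy.typed_state 144 ε δ x dl calls ω hn1
  have hI := fun calls ω => FastGreedy.inv_state 144 ε δ x dl calls ω hn1
  set s := FastGreedy.rows 144 ε δ n
  set L := (ε ^ 2)⁻¹ * Real.log (n / δ)
  have hL0 : 0 ≤ L * (n + d) := by positivity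
  refine ⟨fun ω => ?_, fun calls ω => ?_, fun calls ω => ⟨fun a => ?_, fun y => ?_, ?_⟩,
    fun calls y => ?_, fun calls hcalls => ?_⟩
  · have h := FastGreedy.initTime_le 144 ε δ x dl ω hn1
    refine le_trans ?_ (FastGreedy.init_bounds hn1 hd hL hs1 hs)
    exact_mod_cast h
  · have h := FastGreedy.space_le (hT calls ω)
    have h' : ((FastGreedy.state 144 ε δ x dl calls ω).space : ℝ) ≤
        3 * n + 11 + (n * d + n * s + s * d + 2 * n + d + s + 5) := by exact_mod_cast h
    have hd1 : (1 : ℝ) ≤ d := by exact_mod_cast hd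
    have hn1' : (1 : ℝ) ≤ n := by exact_mod_cast hn1
    have h3 : 1 / 2 * (n + d : ℝ) ≤ L * (n + d) := by gcongr
    have h4 : (0 : ℝ) ≤ n * d := by positivity
    linarith
  · have h := (FastGreedy.runs_update n d s _ (FastGreedy.typed_load (hT calls ω) (.update a))).2
    have h' : ((FastGreedy.Call.update a).time (FastGreedy.state 144 ε δ x dl calls ω) : ℝ) ≤
      400 * ((s : ℝ) * d + n * s + s + n + 1) := by exact_mod_cast h
    linarith
  · have h := (FastGreedy.runs_query n d s _ (FastGreedy.typed_load (hT calls ω) (.query y))).2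
    have h' : ((FastGreedy.Call.query y : FastGreedy.Call n d).time
      (FastGreedy.state 144 ε δ x dl calls ω) : ℝ) ≤
      100 * ((s : ℝ) * d + n * s + s + n + 1) := by exact_mod_cast h
    linarith
  · have h := (FastGreedy.runs_totalWeight n d s _
      (FastGreedy.typed_load (hT calls ω) .totalWeight)).2
    have h' : ((FastGreedy.Call.totalWeight : FastGreedy.Call n d).time
      (FastGreedy.state 144 ε δ x dl calls ω) : ℝ) ≤ 10 := by exact_mod_cast h
    linarith
  -- Calls never alter the matrix or the sketched sellers, so only the one point `y` matters, at
  -- full distortion `ε`.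
  · refine (FastGreedy.sketch_accurate (η := ε) hε hε1 hδ hδ1 hn (by linarith) hε1.le x [y]
      (by simpa using hn1)).trans (measure_mono fun ω hω i => ?_)
    rw [(hI calls ω).static.estimate y i]
    exact hω y (by simp) i
  -- All buyers at once, at distortion `ε / 2`; the limit of `n` buyers is what the union bound can
  -- afford.
  · refine (FastGreedy.sketch_accurate (η := ε / 2) hε hε1 hδ hδ1 hn le_rfl (by linarith) x
      (FastGreedy.buyers (FastGreedy.arrivals calls))
      (by rwa [FastGreedy.length_buyers])).trans (measure_mono fun ω hω => ?_)
    have hg := (hI calls ω).greedy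
    have hc := hg.competitive x hε hε1 fun i t y hy =>
      hω y (FastGreedy.mem_buyers (List.mem_of_getElem? hy.2)) i
    simp only [Set.mem_ofPred_eq, FastGreedy.totalWeightValue_eq]
    exact ⟨hg.isMatching, hc⟩
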